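/- **Setting.** Let $X_1,X_2,\dots$ be random variables on $(\Omega,\mathcal F,P)$ with values in a measurable space $\Xi$, $\mathbf X_n=(X_1,\dots,X_n)$. Let $\{P_\theta:\theta\in\Theta\}$ be a family of laws of the process (the true law need not belong to it), where $\Theta=\prod_k\Theta_k$ is a (possibly infinite) product of measurable spaces, and let $\pi$ be a prior probability on $\Theta$. For each $n$ the law of $\mathbf X_n$ under $P$ and under $P_\theta$ has density $p$, resp. $f_\theta$, with respect to a common measure. Write $R_n(\theta)=f_\theta(\mathbf X_n)/p(\mathbf X_n)$, $P_{\theta|\mathbf X_n}(A)=\int_A f_\theta(\mathbf X_n)\,d\pi/\int_\Theta f_\theta(\mathbf X_n)\,d\pi$, $h(A)=\operatorname{ess\,inf}_{\theta\in A}h(\theta)$, $J(\theta)=h(\theta)-h(\Theta)$, $J(A)=\operatorname{ess\,inf}_{\theta\in A}J(\theta)$ (essential infima with respect to $\pi$), where $h:\Theta\to[0,\infty]$ is as follows. Assume: * (S1) $R_n(\theta)$ is jointly measurable in the data and $\theta$. * (S2) For each $\theta$, $\frac1n\log R_n(\theta)\to-h(\theta)$ $P$-a.s. * (S3) For each $\theta$,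 $h(\theta)=\lim_n\frac1nE_P\log\frac{p(\mathbf X_n)}{f_\theta(\mathbf X_n)}\in[0,\infty]$ exists, and $h$ is measurable. * (S4) $\pi(I)<1$, where $I=\{h=\infty\}$. * (S5) There are measurable sets $\mathcal G_n\to\Theta$ (each $\theta$ lies in $\mathcal G_n$ for all large $n$) with: (1) $\pi(\mathcal G_n)\ge 1-a e^{-\varsigma n}$ for some $a>0$, $\varsigma>2h(\Theta)$; (2) $P$-a.s., $\sup_{\theta\in\mathcal G_n\setminus I}|\frac1n\log R_n(\theta)+h(\theta)|\to0$ and, for every $K$, for all large $n$, $\frac1n\log R_n(\theta)\le K$ for $\pi$-almost every $\theta\in\mathcal G_n\cap I$ (this is void if $\pi(I)=0$); (3) $h(\mathcal G_n)\to h(\Theta)$. * (S6) For every $\delta>0$, $P$-a.s., for all sufficiently large $n$: for all $k\ge n$, $\frac1k\log\int_{\mathcal G_n}R_k\,d\pi\le\delta+\limsup_{j}\frac1j\log\int_{\mathcal G_n}R_j\,d\pi$. * (S7) $h(\mathcal G_n\cap A)\to h(A)$ for every measurable $A$ with $\pi(A)>0$. **Multiple testing.** Let $\theta_1,\dots,\theta_m$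 be distinct coordinates of $\theta$ and test $H_{0i}:\theta_i\in\Theta_{0i}$ against $H_{1i}:\theta_i\in\Theta_{1i}$, where $\Theta_{0i},\Theta_{1i}$ are complementary measurable subsets of $\Theta_i$, $i=1,\dots,m$. Each $i$ has a group $G_i\subseteq\{1,\dots,m\}$ with $i\in G_i$. For $d\in\{0,1\}^m$ ($d_i=1$ means rejecting $H_{0i}$) let $\Theta(d)=\bigcap_i H_{d_i,i}$, $v_{in}=P_{\theta|\mathbf X_n}(H_{1i})$ and $w_{in}(d)=P_{\theta|\mathbf X_n}\big(H_{1i}\cap\bigcap_{j\in G_i\setminus\{i\}}H_{d_j,j}\big)$. The true configuration $d^t$ is the unique one with $J(\Theta(d^t))=J(\Theta)$ (assumed to exist); the $i$-th null is true if $d^t_i=0$ and false otherwise. A non-marginal procedure with constants $\beta_n\in[0,1]$ is a measurable $\hat d_n=\hat d_n(\mathbf X_n)$ that maximizes $\sum_i d_i(w_{in}(d)-\beta_n)$ over $d\in\{0,1\}^m$. Put $$mFDR_{\mathbf X_n}=\frac{\sum_i\hat d_{n,i}(1-w_{in}(\hat d_n))}{\left(\sum_i\hat d_{n,i}\right)\vee1},\qquad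 FNR_{\mathbf X_n}=\frac{\sum_i(1-\hat d_{n,i})v_{in}}{\left(\sum_i(1-\hat d_{n,i})\right)\vee1},$$ $mpBFDR=E[mFDR_{\mathbf X_n}\mid\hat d_n\ne\mathbf 0]$ and $pBFNR=E[FNR_{\mathbf X_n}\mid\hat d_n\neq\mathbf 1]$, the expectations being under $P$ (and $0$ if the conditioning event is null). Let $\tilde H_{\min}=\min_{i:d^t_i=0}J(H_{1i})$. Assume $\varsigma>2h(H_{1i})$ for every $i$ with $d^t_i=0$ and $\pi(H_{1i})>0$, and * (B1) if $m_1$ is the number of indices $i$ such that $G_i$ contains a false null, then $m_1<m$, and none of the $m-m_1$ groups consisting of true nulls only overlaps with any of the $m_1$ other groups. **Theorem.** Let $\hat d_n$ be a non-marginal procedure with constants $\beta_n\in[0,1]$ such that $mpBFDR\to\alpha$ for some $\alpha>0$. Then: 1. almost surely $\displaystyle\limsup_{n\to\infty}\frac1n\log FNR_{\mathbf X_n}\le-\tilde H_{\min}$; 2. the decay is at least as fast as without $\alpha$-control: if $\hat d'_n$ is a non-marginal procedure with constants $\beta'_n\in[0,1]$ such that $0<\liminf\beta'_n$ and $\limsup\beta'_n<1$,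 and $FNR'_{\mathbf X_n}$ is its posterior false non-discovery rate, then almost surely $\displaystyle\limsup_{n}\frac1n\log FNR_{\mathbf X_n}\le\liminf_{n}\frac1n\log FNR'_{\mathbf X_n}$; 3. if $\alpha$ lies in the feasible range $\alpha<\dfrac{m-m_1}{\sum_{i=1}^m d^t_i+m-m_1}$, then $pBFNR\to0$. -/

import Mathlib

open MeasureTheory ProbabilityTheory Filter Topology
open scoped ENNReal

namespace NonMarginal

/-! ### Posterior convergence: the statistical model and its regularity conditions -/

/-- A data process `X 0, X 1, …` with true law `P`, a family `Q θ` of candidate laws of the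
process, a prior, and, for every sample size `n`, a reference measure on the sample space with
respect to which the true law of the first `n` observations has density `p n` and the law of
the first `n` observations under `θ` has density `f n θ`.  The true law is not assumed to belong
to the family. -/
structure BayesModel (Ω Ξ Θ : Type*) [MeasurableSpace Ω] [MeasurableSpace Ξ]
    [MeasurableSpace Θ] where
  P : Measure Ω
  prob_P : IsProbabilityMeasure P
  X : ℕ → Ω → Ξ
  measurable_X : ∀ k, Measurable (X k)
  Q : Θ → Measure (ℕ → Ξ)
  prob_Q : ∀ θ, IsProbabilityMeasure (Q θ)
  prior : Measure Θ
  prob_prior : IsProbabilityMeasure prior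
  ref : (n : ℕ) → Measure (Fin n → Ξ)
  p : (n : ℕ) → (Fin n → Ξ) → ℝ≥0∞
  measurable_p : ∀ n, Measurable (p n)
  f : (n : ℕ) → Θ → (Fin n → Ξ) → ℝ≥0∞
  measurable_f : ∀ n θ, Measurable (f n θ)
  density_p : ∀ n, P.map (fun ω (k : Fin n) => X k ω) = (ref n).withDensity (p n)
  density_f : ∀ n θ, (Q θ).map (fun x (k : Fin n) => x k) = (ref n).withDensity (f n θ)

namespace BayesModel

variable {Ω Ξ Θ : Type*} [MeasurableSpace Ω] [MeasurableSpace Ξ] [MeasurableSpace Θ]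
  (M : BayesModel Ω Ξ Θ)

/-- The data set consisting of the first `n` observations. -/
def data (n : ℕ) (ω : Ω) : Fin n → Ξ := fun k => M.X k ω

/-- True (marginal) law of the first `n` observations. -/
noncomputable def law (n : ℕ) : Measure (Fin n → Ξ) := M.P.map (M.data n)

/-- Law of the first `n` observations under the parameter `θ`. -/
noncomputable def modelLaw (n : ℕ) (θ : Θ) : Measure (Fin n → Ξ) :=
  (M.Q θ).map (fun x (k : Fin n) => x k)

/-- Likelihood ratio `R_n(θ) = f_θ(x) / p(x)`. -/
noncomputable def ratio (n : ℕ) (θ : Θ) (x : Fin n → Ξ) : ℝ≥0∞ := M.f n θ x / M.p n x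

/-- `n⁻¹ log R_n(θ)`, with values in `[-∞, ∞]`. -/
noncomputable def logRatio (n : ℕ) (θ : Θ) (x : Fin n → Ξ) : EReal :=
  ENNReal.log (M.ratio n θ x) / (n : EReal)

/-- `n⁻¹ log ∫_A R_n(θ) dπ(θ)`, with values in `[-∞, ∞]`. -/
noncomputable def logMass (A : Set Θ) (n : ℕ) (x : Fin n → Ξ) : EReal :=
  ENNReal.log (∫⁻ θ in A, M.ratio n θ x ∂M.prior) / (n : EReal)

/-- Posterior probability of `A` given the data `x`. -/
noncomputable def post (n : ℕ) (x : Fin n → Ξ) (A : Set Θ) : ℝ :=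
  ((∫⁻ θ in A, M.f n θ x ∂M.prior) / ∫⁻ θ, M.f n θ x ∂M.prior).toReal

/-- `h(A)`, the essential infimum of `h` over `A` under the prior. -/
noncomputable def hSet (h : Θ → ℝ≥0∞) (A : Set Θ) : ℝ≥0∞ := essInf h (M.prior.restrict A)

/-- `J(A)`, the essential infimum of `J(θ) = h(θ) - h(Θ)` over `A` under the prior. -/
noncomputable def J (h : Θ → ℝ≥0∞) (A : Set Θ) : EReal :=
  essInf (fun θ => (h θ : EReal) - (M.hSet h Set.univ : EReal)) (M.prior.restrict A)

/-- `n > τ(A, δ)`: from time `n` on, `k⁻¹ log ∫_A R_k dπ` exceeds its limit superior by at most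
`δ`, along the realization `ω`. -/
def AfterLastEntry (A : Set Θ) (δ : ℝ) (n : ℕ) (ω : Ω) : Prop :=
  ∀ k, n ≤ k → M.logMass A k (M.data k ω) ≤
    (δ : EReal) + limsup (fun j => M.logMass A j (M.data j ω)) atTop

/-- Regularity conditions for posterior convergence: `h` is the Kullback–Leibler divergence rate,
`S n` are the sieves, and the prior mass outside `S n` is at most `a * exp (-ς n)`. -/
structure Regular (h : Θ → ℝ≥0∞) (S : ℕ → Set Θ) (a ς : ℝ) : Prop where
  /-- joint measurability of the likelihood ratio -/
  measurable_ratio : ∀ n, Measurable (fun z : (Fin n → Ξ) × Θ => M.ratio n z.2 z.1)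
  /-- asymptotic equipartition property -/
  equipartition : ∀ θ, ∀ᵐ ω ∂M.P,
    Tendsto (fun n => M.logRatio n θ (M.data n ω)) atTop (𝓝 (-(h θ : EReal)))
  /-- existence of the divergence rate -/
  divergence_rate : ∀ θ,
    Tendsto (fun n : ℕ => InformationTheory.klDiv (M.law n) (M.modelLaw n θ) / (n : ℝ≥0∞)) atTop
      (𝓝 (h θ))
  measurable_h : Measurable h
  not_all_infinite : M.prior {θ | h θ = ⊤} < 1
  measurable_sieve : ∀ n, MeasurableSet (S n)
  /-- the sieves converge to the parameter space -/
  sieve_tendsto : ∀ θ, ∀ᶠ n in atTop, θ ∈ S n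
  a_pos : 0 < a
  rate_gt : 2 * M.hSet h Set.univ < ENNReal.ofReal ς
  sieve_mass : ∀ n : ℕ, 1 - a * Real.exp (-ς * n) ≤ (M.prior (S n)).toReal
  /-- uniform convergence in the equipartition property over the sieves, where `h` is finite -/
  uniform_finite : ∀ᵐ ω ∂M.P, ∀ ε : ℝ, 0 < ε → ∀ᶠ n in atTop, ∀ θ ∈ S n, h θ ≠ ⊤ →
    -(h θ : EReal) - (ε : EReal) ≤ M.logRatio n θ (M.data n ω) ∧
      M.logRatio n θ (M.data n ω) ≤ -(h θ : EReal) + (ε : EReal)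
  /-- uniform divergence to `-∞` over the sieves, where `h` is infinite
  (void if `h` is finite almost everywhere under the prior) -/
  uniform_infinite : ∀ᵐ ω ∂M.P, ∀ K : ℝ, ∀ᶠ n in atTop, ∀ᵐ θ ∂M.prior, θ ∈ S n → h θ = ⊤ →
    M.logRatio n θ (M.data n ω) ≤ (K : EReal)
  hSet_sieve : Tendsto (fun n => M.hSet h (S n)) atTop (𝓝 (M.hSet h Set.univ))
  last_entry : ∀ δ : ℝ, 0 < δ → ∀ᵐ ω ∂M.P, ∀ᶠ n in atTop, M.AfterLastEntry (S n) δ n ω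
  hSet_sieve_inter : ∀ A : Set Θ, MeasurableSet A → M.prior A ≠ 0 →
    Tendsto (fun n => M.hSet h (S n ∩ A)) atTop (𝓝 (M.hSet h A))

end BayesModel

/-! ### Multiple testing -/

/-- A decision configuration; `true` means that the null hypothesis is rejected. -/
abbrev Config (m : ℕ) := Fin m → Bool

/-- The value `0` or `1` of a decision. -/
def ind (b : Bool) : ℝ := if b then 1 else 0

/-- `m` hypotheses on distinct coordinates of a product parameter space: the `i`-th null
hypothesis says that coordinate `coord i` lies outside `alt i`, the `i`-th alternative that it
lies in `alt i`; `group i` is the group of the `i`-th hypothesis. -/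
structure TestingProblem {ι : Type*} (T : ι → Type*) [∀ k, MeasurableSpace (T k)] (m : ℕ) where
  coord : Fin m ↪ ι
  alt : (i : Fin m) → Set (T (coord i))
  measurable_alt : ∀ i, MeasurableSet (alt i)
  group : Fin m → Finset (Fin m)
  self_mem_group : ∀ i, i ∈ group i

namespace TestingProblem

variable {ι : Type*} {T : ι → Type*} [∀ k, MeasurableSpace (T k)] {m : ℕ}
  (H : TestingProblem T m)

/-- The parameters for which the `i`-th alternative (`b = true`) or null hypothesis
(`b = false`) is true. -/
def hyp (i : Fin m) (b : Bool) : Set ((k : ι) → T k) :=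
  {θ | θ (H.coord i) ∈ H.alt i ↔ b = true}

/-- `Θ(d)`: the parameters for which all decisions in `d` are correct. -/
def cell (d : Config m) : Set ((k : ι) → T k) := ⋂ i, H.hyp i (d i)

/-- The parameters for which the `i`-th alternative is true and the decisions in `d` on all other
members of the group of `i` are correct. -/
def groupCell (i : Fin m) (d : Config m) : Set ((k : ι) → T k) :=
  H.hyp i true ∩ ⋂ j ∈ (H.group i).erase i, H.hyp j (d j)

/-- The indices whose group contains at least one false null hypothesis, when `dt` is the true
configuration. -/
def signalGroups (dt : Config m) : Finset (Fin m) :=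
  Finset.univ.filter (fun i => ∃ j ∈ H.group i, dt j = true)

/-- The isolated-groups condition: not every group contains a false null hypothesis, and the
groups consisting of true nulls only do not overlap with the other groups. -/
def IsolatedGroups (dt : Config m) : Prop :=
  (H.signalGroups dt).card < m ∧
    ∀ i ∈ H.signalGroups dt, ∀ j ∉ H.signalGroups dt, Disjoint (H.group i) (H.group j)

variable {Ω Ξ : Type*} [MeasurableSpace Ω] [MeasurableSpace Ξ]
  (M : BayesModel Ω Ξ ((k : ι) → T k))

/-- `dt` is the true configuration: the only one with `J(Θ(dt)) = J(Θ)`. -/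
def IsTrueConfig (h : ((k : ι) → T k) → ℝ≥0∞) (dt : Config m) : Prop :=
  M.J h (H.cell dt) = M.J h Set.univ ∧
    ∀ d : Config m, M.J h (H.cell d) = M.J h Set.univ → d = dt

/-- `v_{in}`, posterior probability of the `i`-th alternative. -/
noncomputable def v (n : ℕ) (x : Fin n → Ξ) (i : Fin m) : ℝ := M.post n x (H.hyp i true)

/-- `w_{in}(d)`. -/
noncomputable def w (n : ℕ) (x : Fin n → Ξ) (i : Fin m) (d : Config m) : ℝ :=
  M.post n x (H.groupCell i d)

/-- The criterion `f_β(d) = ∑ d_i (w_{in}(d) - β)`. -/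
noncomputable def criterion (n : ℕ) (x : Fin n → Ξ) (β : ℝ) (d : Config m) : ℝ :=
  ∑ i, ind (d i) * (H.w M n x i d - β)

/-- `dhat` is a non-marginal procedure with penalizing constants `β n`: for every sample size it
is a measurable function of the data that maximizes the criterion (ties are broken
arbitrarily). -/
def IsNonMarginal (β : ℕ → ℝ) (dhat : (n : ℕ) → (Fin n → Ξ) → Config m) : Prop :=
  ∀ n, Measurable (dhat n) ∧
    ∀ x d, H.criterion M n x (β n) d ≤ H.criterion M n x (β n) (dhat n x)

/-- Modified posterior false discovery rate of the decision `d` given the data `x`. -/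
noncomputable def mFDR (n : ℕ) (x : Fin n → Ξ) (d : Config m) : ℝ :=
  (∑ i, ind (d i) * (1 - H.w M n x i d)) / max (∑ i, ind (d i)) 1

/-- Posterior false non-discovery rate of the decision `d` given the data `x`. -/
noncomputable def FNR (n : ℕ) (x : Fin n → Ξ) (d : Config m) : ℝ :=
  (∑ i, (1 - ind (d i)) * H.v M n x i) / max (∑ i, (1 - ind (d i))) 1

/-- `mpBFDR`: expectation of the modified posterior FDR of the procedure, conditionally on at
least one rejection. -/
noncomputable def mpBFDR (dhat : (n : ℕ) → (Fin n → Ξ) → Config m) (n : ℕ) : ℝ :=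
  ∫ x, H.mFDR M n x (dhat n x) ∂(M.law n)[|{x | dhat n x ≠ fun _ => false}]

/-- `pBFNR`: expectation of the posterior FNR of the procedure, conditionally on at least one
acceptance. -/
noncomputable def pBFNR (dhat : (n : ℕ) → (Fin n → Ξ) → Config m) (n : ℕ) : ℝ :=
  ∫ x, H.FNR M n x (dhat n x) ∂(M.law n)[|{x | dhat n x ≠ fun _ => true}]

/-- `n⁻¹ log FNR` of the procedure along the realization `ω`, with values in `[-∞, ∞]`. -/
noncomputable def logFNR (dhat : (n : ℕ) → (Fin n → Ξ) → Config m) (n : ℕ) (ω : Ω) : EReal :=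
  ENNReal.log (ENNReal.ofReal (H.FNR M n (M.data n ω) (dhat n (M.data n ω)))) / (n : EReal)

/-- `H̃_min`, the minimum of `J(H_{1i})` over the true null hypotheses `i`. -/
noncomputable def HtildeMin (h : ((k : ι) → T k) → ℝ≥0∞) (dt : Config m) : EReal :=
  ⨅ i : {i : Fin m // dt i = false}, M.J h (H.hyp i true)

end TestingProblem

end NonMarginal

/-!
Write `mass A` for `∫_A R_n dπ`; almost surely the posterior probability of `A` is
`mass A / mass Θ`.

*Rates of the posterior.* On the sieves the normalized log-likelihood ratio is uniformly close to
`-h`, and outside them the mass has expectation at most `a exp (-ς n)`, so that it decays at any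
rate below `ς` by Markov's inequality and the Borel–Cantelli lemma. Hence `mass A` decays
exponentially at rate `h(A)` as long as `h(A) < ς` (`Regular.mass_le`, `Regular.le_mass`), and the
posterior probability of `A` at rate `J(A) = h(A) - h(Θ)` (`Regular.post_le_exp`,
`Regular.exp_le_post`). A set with `h(A) > h(Θ)` always loses its posterior probability, so the
posterior concentrates on the true configuration `dt` (`IsTrueConfig.tendsto_post_cell`).

*What a maximizer decides.* Let `ε` be the posterior probability that `dt` is wrong. Comparing a
maximizer with `dt` term by term (`criterion_gap_le`) shows that it rejects every false null if
`2 m ε < 1 - β` and accepts every true null if `2 m ε < β`. Comparing it with the decision to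
reject nothing bounds its modified FDR by `1 - β` (`mFDR_le_one_sub`). Hence a positive limit of
`mpBFDR` keeps `β_n` away from `1`, and almost surely all false nulls are eventually rejected.

*Conclusions.* Once all false nulls are rejected, the FNR is at most the sum of the `v_{in}` over
the true nulls, whose rate is the minimum of `J(H_{1i})`. A procedure whose constants stay away
from `0` eventually accepts all true nulls, so its FNR is at least `v_{in} / m` for each of them
and decays no faster. For the expectation, rejecting everything has a modified FDR close to the
proportion of true nulls. In the feasible range this exceeds `α`, so the probability of rejecting
everything stays away from `1` (`card_div_mul_le_mpBFDR`); conditioning on its complement costs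
only a bounded factor, and dominated convergence applies.
-/

namespace NonMarginal

/-! ### Exponential rates -/

lemma log_div_le_iff {y : ℝ≥0∞} {n : ℕ} (hn : 0 < n) (c : ℝ) :
    ENNReal.log y / (n : EReal) ≤ (c : EReal) ↔ y ≤ ENNReal.ofReal (Real.exp (n * c)) := by
  rw [EReal.div_le_iff_le_mul (by exact_mod_cast hn) (by exact_mod_cast EReal.natCast_ne_top n),
    ← EReal.exp_le_exp_iff, ENNReal.exp_log, ← EReal.exp_coe]
  norm_cast

lemma le_log_div_iff {y : ℝ≥0∞} {n : ℕ} (hn : 0 < n) (c : ℝ) :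
    (c : EReal) ≤ ENNReal.log y / (n : EReal) ↔ ENNReal.ofReal (Real.exp (n * c)) ≤ y := by
  rw [EReal.le_div_iff_mul_le (by exact_mod_cast hn) (by exact_mod_cast EReal.natCast_ne_top n),
    ← EReal.exp_le_exp_iff, ENNReal.exp_log, ← EReal.exp_coe, mul_comm]
  norm_cast

/-- A constant factor is absorbed by an arbitrarily small change of the exponential rate. -/
lemma eventually_mul_exp_le (C : ℝ) {b c : ℝ} (h : b < c) :
    ∀ᶠ n : ℕ in atTop, C * Real.exp (n * b) ≤ Real.exp (n * c) := by
  have h1 : Tendsto (fun n : ℕ => Real.exp (n * (c - b))) atTop atTop :=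
    Real.tendsto_exp_atTop.comp
      (tendsto_natCast_atTop_atTop.atTop_mul_const (sub_pos.2 h))
  filter_upwards [h1.eventually_ge_atTop C] with n hn
  calc C * Real.exp (n * b) ≤ Real.exp (n * (c - b)) * Real.exp (n * b) := by gcongr
    _ = Real.exp (n * c) := by rw [← Real.exp_add]; ring_nf

lemma tendsto_exp_nat_mul_of_neg {c : ℝ} (hc : c < 0) :
    Tendsto (fun n : ℕ => Real.exp (n * c)) atTop (𝓝 0) :=
  Real.tendsto_exp_atBot.comp (tendsto_natCast_atTop_atTop.atTop_mul_const_of_neg hc)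

namespace BayesModel

variable {Ω Ξ Θ : Type*} [MeasurableSpace Ω] [MeasurableSpace Ξ] [MeasurableSpace Θ]
  (M : BayesModel Ω Ξ Θ)

instance : IsProbabilityMeasure M.P := M.prob_P

instance : IsProbabilityMeasure M.prior := M.prob_prior

instance (θ : Θ) : IsProbabilityMeasure (M.Q θ) := M.prob_Q θ

lemma measurable_data (n : ℕ) : Measurable (M.data n) :=
  measurable_pi_lambda _ fun k => M.measurable_X k

instance (n : ℕ) : IsProbabilityMeasure (M.law n) :=
  Measure.isProbabilityMeasure_map (M.measurable_data n).aemeasurable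

lemma law_eq (n : ℕ) : M.law n = (M.ref n).withDensity (M.p n) := M.density_p n

/-! ### Likelihood ratios integrated over sets of parameters -/

lemma ae_p_ne (n : ℕ) : ∀ᵐ x ∂M.law n, M.p n x ≠ 0 ∧ M.p n x ≠ ⊤ := by
  have h1 : ∫⁻ x, M.p n x ∂M.ref n = 1 := by
    have := measure_univ (μ := M.law n)
    rwa [law_eq, withDensity_apply _ MeasurableSet.univ, Measure.restrict_univ] at this
  rw [law_eq, ae_withDensity_iff (M.measurable_p n)]
  filter_upwards [ae_lt_top (M.measurable_p n) (by simp [h1])] with x hx h0 using ⟨h0, hx.ne⟩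

lemma lintegral_ratio_le_one (n : ℕ) (θ : Θ) : ∫⁻ x, M.ratio n θ x ∂M.law n ≤ 1 := by
  have h1 : ∫⁻ x, M.f n θ x ∂M.ref n = 1 := by
    have hm : Measurable (fun (x : ℕ → Ξ) (k : Fin n) => x k) :=
      measurable_pi_lambda _ fun k => measurable_pi_apply _
    have := Measure.isProbabilityMeasure_map (μ := M.Q θ) hm.aemeasurable
    have := measure_univ (μ := (M.Q θ).map (fun (x : ℕ → Ξ) (k : Fin n) => x k))
    rwa [M.density_f, withDensity_apply _ MeasurableSet.univ, Measure.restrict_univ] at this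
  have hr : Measurable (M.ratio n θ) := (M.measurable_f n θ).div (M.measurable_p n)
  rw [law_eq, lintegral_withDensity_eq_lintegral_mul _ (M.measurable_p n) hr, ← h1]
  exact lintegral_mono fun x => ENNReal.mul_div_le

/-- `∫_A R_n(θ) dπ(θ)`, the unnormalized posterior mass of `A` relative to the true density. -/
noncomputable def mass (n : ℕ) (x : Fin n → Ξ) (A : Set Θ) : ℝ≥0∞ :=
  ∫⁻ θ in A, M.ratio n θ x ∂M.prior

variable {M} {h : Θ → ℝ≥0∞} {S : ℕ → Set Θ} {a ς : ℝ}

lemma Regular.measurable_mass (hreg : M.Regular h S a ς) (n : ℕ) (A : Set Θ) :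
    Measurable (fun x => M.mass n x A) :=
  (hreg.measurable_ratio n).lintegral_prod_right'

lemma Regular.measurable_ratio_right (hreg : M.Regular h S a ς) (n : ℕ) (x : Fin n → Ξ) :
    Measurable (fun θ => M.ratio n θ x) :=
  (hreg.measurable_ratio n).comp measurable_prodMk_left

/-- Under the true law the expected unnormalized mass of `A` is at most its prior mass. -/
lemma Regular.lintegral_mass_le (hreg : M.Regular h S a ς) (n : ℕ) (A : Set Θ) :
    ∫⁻ x, M.mass n x A ∂M.law n ≤ M.prior A := by
  unfold mass
  rw [lintegral_lintegral_swap (hreg.measurable_ratio n).aemeasurable]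
  calc ∫⁻ θ in A, ∫⁻ x, M.ratio n θ x ∂M.law n ∂M.prior ≤ ∫⁻ _ in A, 1 ∂M.prior :=
        lintegral_mono fun θ => M.lintegral_ratio_le_one n θ
    _ = M.prior A := by simp

lemma Regular.prior_compl_sieve_le (hreg : M.Regular h S a ς) (n : ℕ) :
    M.prior (S n)ᶜ ≤ ENNReal.ofReal (a * Real.exp (-ς * n)) := by
  have h1 := hreg.sieve_mass n
  change _ ≤ M.prior.real (S n) at h1
  have h2 := probReal_compl_eq_one_sub (μ := M.prior) (hreg.measurable_sieve n)
  rw [← ofReal_measureReal]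
  exact ENNReal.ofReal_le_ofReal (by linarith)

/-- Outside the sieves the mass decays at any rate below `ς`, by Markov's inequality and the
Borel–Cantelli lemma. -/
lemma Regular.mass_compl_sieve_le (hreg : M.Regular h S a ς) {c : ℝ} (hc : c < ς) :
    ∀ᵐ ω ∂M.P, ∀ᶠ n : ℕ in atTop,
      M.mass n (M.data n ω) (S n)ᶜ ≤ ENNReal.ofReal (Real.exp (n * -c)) := by
  set B : ℕ → Set Ω := fun n =>
    {ω | ENNReal.ofReal (Real.exp (n * -c)) ≤ M.mass n (M.data n ω) (S n)ᶜ}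
  have hB : ∀ n, M.P (B n) ≤ ENNReal.ofReal (a * Real.exp (-(ς - c)) ^ n) := by
    intro n
    have hpos := Real.exp_pos (n * -c)
    have h1 : ∫⁻ ω, M.mass n (M.data n ω) (S n)ᶜ ∂M.P ≤
        ENNReal.ofReal (a * Real.exp (-ς * n)) := by
      have h2 := hreg.lintegral_mass_le n (S n)ᶜ
      rw [law, lintegral_map (hreg.measurable_mass n _) (M.measurable_data n)] at h2
      exact h2.trans (hreg.prior_compl_sieve_le n)
    refine (meas_ge_le_lintegral_div
      ((hreg.measurable_mass n _).comp (M.measurable_data n)).aemeasurable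
      (by simpa using hpos) ENNReal.ofReal_ne_top).trans ?_
    refine (ENNReal.div_le_div_right h1 _).trans ?_
    rw [← ENNReal.ofReal_div_of_pos hpos]
    refine ENNReal.ofReal_le_ofReal (le_of_eq ?_)
    rw [mul_div_assoc, ← Real.exp_sub, ← Real.exp_nat_mul]
    ring_nf
  have hsum : ∑' n, M.P (B n) ≠ ∞ := by
    refine ne_top_of_le_ne_top ?_ (ENNReal.tsum_le_tsum hB)
    have hs : Summable fun n : ℕ => a * Real.exp (-(ς - c)) ^ n :=
      (summable_geometric_of_lt_one (Real.exp_pos _).le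
        (Real.exp_lt_one_iff.2 (by linarith))).mul_left a
    rw [← ENNReal.ofReal_tsum_of_nonneg (fun n => mul_nonneg hreg.a_pos.le (by positivity)) hs]
    exact ENNReal.ofReal_ne_top
  filter_upwards [ae_eventually_notMem hsum] with ω hω
  filter_upwards [hω] with n hn
  exact (not_le.1 hn).le

lemma Regular.mass_inter_sieve_le (hreg : M.Regular h S a ς) {A : Set Θ} (hA : MeasurableSet A)
    {c : ℝ} (hc : (c : EReal) < (M.hSet h A : EReal)) :
    ∀ᵐ ω ∂M.P, ∀ᶠ n : ℕ in atTop,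
      M.mass n (M.data n ω) (S n ∩ A) ≤ ENNReal.ofReal (Real.exp (n * -c)) := by
  obtain ⟨c', hcc', hc'⟩ := EReal.lt_iff_exists_real_btwn.1 hc
  have hpos : 0 < c' - c := sub_pos.2 (EReal.coe_lt_coe_iff.1 hcc')
  have hess : ∀ᵐ θ ∂M.prior, θ ∈ A → M.hSet h A ≤ h θ := by
    rw [← ae_restrict_iff' hA]
    exact ae_essInf_le
  filter_upwards [hreg.uniform_finite, hreg.uniform_infinite] with ω h1 h2
  filter_upwards [h1 _ hpos, h2 (-c), eventually_gt_atTop 0] with n hn1 hn2 hn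
  have key : ∀ᵐ θ ∂M.prior, θ ∈ S n ∩ A →
      M.ratio n θ (M.data n ω) ≤ ENNReal.ofReal (Real.exp (n * -c)) := by
    filter_upwards [hess, hn2] with θ hθ hθ2 hmem
    rw [← log_div_le_iff hn]
    by_cases htop : h θ = ⊤
    · exact hθ2 hmem.1 htop
    · refine (hn1 θ hmem.1 htop).2.trans ?_
      have h3 : (c' : EReal) ≤ (h θ : EReal) :=
        hc'.le.trans (by exact_mod_cast hθ hmem.2)
      calc -(h θ : EReal) + ((c' - c : ℝ) : EReal) ≤ -(c' : EReal) + ((c' - c : ℝ) : EReal) := by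
            gcongr
            exact EReal.neg_le_neg_iff.2 h3
        _ = ((-c : ℝ) : EReal) := by norm_cast; ring_nf
  unfold mass
  calc ∫⁻ θ in S n ∩ A, M.ratio n θ (M.data n ω) ∂M.prior
      ≤ ∫⁻ θ in S n ∩ A, ENNReal.ofReal (Real.exp (n * -c)) ∂M.prior :=
        lintegral_mono_ae ((ae_restrict_iff' ((hreg.measurable_sieve n).inter hA)).2 key)
    _ = ENNReal.ofReal (Real.exp (n * -c)) * M.prior (S n ∩ A) := by simp
    _ ≤ ENNReal.ofReal (Real.exp (n * -c)) * 1 := by gcongr; exact prob_le_one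
    _ = _ := mul_one _

/-- The mass of `A` decays at any rate below `h(A)` and `ς`. -/
lemma Regular.mass_le (hreg : M.Regular h S a ς) {A : Set Θ} (hA : MeasurableSet A)
    {c : ℝ} (hc : (c : EReal) < (M.hSet h A : EReal)) (hcς : c < ς) :
    ∀ᵐ ω ∂M.P, ∀ᶠ n : ℕ in atTop,
      M.mass n (M.data n ω) A ≤ ENNReal.ofReal (2 * Real.exp (n * -c)) := by
  filter_upwards [hreg.mass_inter_sieve_le hA hc, hreg.mass_compl_sieve_le hcς] with ω h1 h2
  filter_upwards [h1, h2] with n hn1 hn2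
  have hsub : A ⊆ (S n ∩ A) ∪ (S n)ᶜ := fun θ hθ => by
    by_cases hs : θ ∈ S n
    · exact Or.inl ⟨hs, hθ⟩
    · exact Or.inr hs
  calc M.mass n (M.data n ω) A
      ≤ M.mass n (M.data n ω) ((S n ∩ A) ∪ (S n)ᶜ) := lintegral_mono_set hsub
    _ ≤ M.mass n (M.data n ω) (S n ∩ A) + M.mass n (M.data n ω) (S n)ᶜ :=
        lintegral_union_le _ _ _
    _ ≤ ENNReal.ofReal (Real.exp (n * -c)) + ENNReal.ofReal (Real.exp (n * -c)) :=
        add_le_add hn1 hn2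
    _ = _ := by
        rw [← ENNReal.ofReal_add (by positivity) (by positivity), two_mul]

lemma le_coe_hSet {A : Set Θ} {y : EReal}
    (hy : ∀ᵐ θ ∂M.prior.restrict A, y ≤ (h θ : EReal)) : y ≤ (M.hSet h A : EReal) := by
  have h1 : y.toENNReal ≤ M.hSet h A :=
    le_essInf_of_ae_le _ (hy.mono fun θ hθ => by
      simpa using EReal.toENNReal_le_toENNReal hθ)
  calc y ≤ (y.toENNReal : EReal) := by
        rw [EReal.coe_toENNReal_eq_max]; exact le_max_right _ _
    _ ≤ _ := by exact_mod_cast h1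

/-- The mass of `A` decays at no rate above `h(A)`: the parameters of `A` with divergence rate
close to `h(A)` have positive prior probability and contribute enough. -/
lemma Regular.le_mass (hreg : M.Regular h S a ς) {A : Set Θ} (hA : MeasurableSet A)
    {c : ℝ} (hc : (M.hSet h A : EReal) < (c : EReal)) :
    ∀ᵐ ω ∂M.P, ∀ᶠ n : ℕ in atTop,
      ENNReal.ofReal (Real.exp (n * -c)) ≤ M.mass n (M.data n ω) A := by
  obtain ⟨c₁, hc₁, hcc⟩ := EReal.lt_iff_exists_real_btwn.1 hc
  replace hcc : c₁ < c := EReal.coe_lt_coe_iff.1 hcc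
  set B : Set Θ := A ∩ {θ | (h θ : EReal) < (c₁ : EReal)} with hBdef
  have hBm : MeasurableSet B :=
    hA.inter (measurableSet_lt hreg.measurable_h.coe_ereal_ennreal measurable_const)
  have hB0 : M.prior B ≠ 0 := by
    intro h0
    have h1 : ∀ᵐ θ ∂M.prior.restrict A, (c₁ : EReal) ≤ (h θ : EReal) := by
      rw [ae_restrict_iff' hA]
      filter_upwards [measure_eq_zero_iff_ae_notMem.1 h0] with θ hθ hθA
      exact not_lt.1 fun hlt => hθ ⟨hθA, hlt⟩
    exact absurd hc₁ (not_lt.2 (le_coe_hSet h1))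
  have hςpos : 0 < ς := by
    have := zero_le.trans_lt hreg.rate_gt
    simpa using this
  -- the sieves eventually cover at least half of the prior mass of `B`
  have hhalf : ∀ᶠ n : ℕ in atTop, M.prior.real B / 2 ≤ M.prior.real (B ∩ S n) := by
    have hBpos : 0 < M.prior.real B := by
      rw [Measure.real]; exact ENNReal.toReal_pos hB0 (measure_ne_top _ _)
    have h1 : Tendsto (fun n : ℕ => a * Real.exp (n * -ς)) atTop (𝓝 (a * 0)) :=
      (tendsto_exp_nat_mul_of_neg (by linarith)).const_mul a
    rw [mul_zero] at h1
    filter_upwards [h1.eventually_lt_const (half_pos hBpos)] with n hn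
    have h2 : M.prior.real (S n)ᶜ ≤ a * Real.exp (n * -ς) := by
      refine ENNReal.toReal_le_of_le_ofReal (mul_nonneg hreg.a_pos.le (Real.exp_pos _).le) ?_
      have := hreg.prior_compl_sieve_le n
      rwa [show -ς * (n : ℝ) = n * -ς by ring] at this
    have h3 : M.prior.real B ≤ M.prior.real (B ∩ S n) + M.prior.real (S n)ᶜ := by
      refine (measureReal_mono ?_).trans (measureReal_union_le _ _)
      intro θ hθ
      by_cases hs : θ ∈ S n
      · exact Or.inl ⟨hθ, hs⟩
      · exact Or.inr hs
    linarith
  have hBpos : 0 < M.prior.real B := by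
    rw [Measure.real]; exact ENNReal.toReal_pos hB0 (measure_ne_top _ _)
  set c₂ := (c₁ + c) / 2 with hc₂
  filter_upwards [hreg.uniform_finite] with ω h1
  filter_upwards [h1 (c₂ - c₁) (by linarith), hhalf, eventually_gt_atTop 0,
    eventually_mul_exp_le (M.prior.real B / 2)⁻¹ (show -c < -c₂ by linarith)]
    with n hn1 hn2 hn hn3
  have key : ∀ θ ∈ B ∩ S n,
      ENNReal.ofReal (Real.exp (n * -c₂)) ≤ M.ratio n θ (M.data n ω) := by
    intro θ hθ
    have hlt : (h θ : EReal) < (c₁ : EReal) := hθ.1.2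
    have htop : h θ ≠ ⊤ := by
      intro h0
      rw [h0] at hlt
      exact absurd hlt (by simp)
    rw [← le_log_div_iff hn]
    refine le_trans ?_ (hn1 θ hθ.2 htop).1
    calc ((-c₂ : ℝ) : EReal) = -(c₁ : EReal) - ((c₂ - c₁ : ℝ) : EReal) := by
          norm_cast; ring_nf
      _ ≤ _ := EReal.sub_le_sub (EReal.neg_le_neg_iff.2 hlt.le) le_rfl
  calc ENNReal.ofReal (Real.exp (n * -c))
      ≤ ENNReal.ofReal (Real.exp (n * -c₂) * (M.prior.real B / 2)) := by
        refine ENNReal.ofReal_le_ofReal ?_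
        rw [inv_mul_le_iff₀ (by positivity)] at hn3
        linarith
    _ ≤ ENNReal.ofReal (Real.exp (n * -c₂) * M.prior.real (B ∩ S n)) := by gcongr
    _ = ENNReal.ofReal (Real.exp (n * -c₂)) * M.prior (B ∩ S n) := by
        rw [ENNReal.ofReal_mul (Real.exp_pos _).le, ofReal_measureReal]
    _ = ∫⁻ θ in B ∩ S n, ENNReal.ofReal (Real.exp (n * -c₂)) ∂M.prior := by simp
    _ ≤ ∫⁻ θ in B ∩ S n, M.ratio n θ (M.data n ω) ∂M.prior :=
        setLIntegral_mono (hreg.measurable_ratio_right n _) key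
    _ ≤ M.mass n (M.data n ω) A :=
        lintegral_mono_set fun θ hθ => hθ.1.1

/-! ### Posterior probabilities -/

lemma post_nonneg (n : ℕ) (x : Fin n → Ξ) (A : Set Θ) : 0 ≤ M.post n x A :=
  ENNReal.toReal_nonneg

lemma post_le_one (n : ℕ) (x : Fin n → Ξ) (A : Set Θ) : M.post n x A ≤ 1 :=
  ENNReal.toReal_le_of_le_ofReal zero_le_one <| by
    rw [ENNReal.ofReal_one]
    exact ENNReal.div_le_of_le_mul (by rw [one_mul]; exact setLIntegral_le_lintegral _ _)

lemma post_mono {n : ℕ} {x : Fin n → Ξ} {A B : Set Θ} (hAB : A ⊆ B) :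
    M.post n x A ≤ M.post n x B :=
  ENNReal.toReal_mono
    (ne_top_of_le_ne_top ENNReal.one_ne_top
      (ENNReal.div_le_of_le_mul (by rw [one_mul]; exact setLIntegral_le_lintegral _ _)))
    (ENNReal.div_le_div_right (lintegral_mono_set hAB) _)

/-- Passing from likelihoods to likelihood ratios leaves the posterior unchanged where the true
density is positive and finite, hence almost surely. -/
lemma post_eq_mass_div {n : ℕ} {x : Fin n → Ξ} (h0 : M.p n x ≠ 0) (h1 : M.p n x ≠ ⊤)
    (A : Set Θ) : M.post n x A = (M.mass n x A / M.mass n x Set.univ).toReal := by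
  have key : ∀ μ : Measure Θ, ∫⁻ θ, M.f n θ x ∂μ = (∫⁻ θ, M.ratio n θ x ∂μ) * M.p n x := by
    intro μ
    rw [← lintegral_mul_const' _ _ h1]
    exact lintegral_congr fun θ => (ENNReal.div_mul_cancel h0 h1).symm
  rw [post, mass, mass, Measure.restrict_univ, key, key, ENNReal.mul_div_mul_right _ _ h0 h1]

lemma ae_data_p_ne : ∀ᵐ ω ∂M.P, ∀ n, M.p n (M.data n ω) ≠ 0 ∧ M.p n (M.data n ω) ≠ ⊤ := by
  rw [ae_all_iff]
  intro n
  exact ae_of_ae_map (M.measurable_data n).aemeasurable (M.ae_p_ne n)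

lemma Regular.aemeasurable_post (hreg : M.Regular h S a ς) (n : ℕ) (A : Set Θ) :
    AEMeasurable (fun x => M.post n x A) (M.law n) :=
  ⟨fun x => (M.mass n x A / M.mass n x Set.univ).toReal,
    ((hreg.measurable_mass n A).div (hreg.measurable_mass n _)).ennreal_toReal, by
      filter_upwards [M.ae_p_ne n] with x hx using post_eq_mass_div hx.1 hx.2 A⟩

lemma toReal_lt_of_two_mul_lt {y : ℝ≥0∞} {b : ℝ} (hy : 2 * y < ENNReal.ofReal b) :
    y ≠ ⊤ ∧ y.toReal < b := by
  have hb : 0 < b := by simpa using zero_le.trans_lt hy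
  have htop : y ≠ ⊤ := by
    rintro rfl
    rw [ENNReal.mul_top (by simp)] at hy
    exact not_top_lt hy
  rw [← ENNReal.ofReal_toReal htop, show (2 : ℝ≥0∞) = ENNReal.ofReal 2 by simp,
    ← ENNReal.ofReal_mul (by norm_num), ENNReal.ofReal_lt_ofReal_iff hb] at hy
  exact ⟨htop, by linarith [ENNReal.toReal_nonneg (a := y)]⟩

lemma Regular.hSet_univ_ne_top (hreg : M.Regular h S a ς) : M.hSet h Set.univ ≠ ⊤ :=
  (toReal_lt_of_two_mul_lt hreg.rate_gt).1

lemma hSet_univ_le (A : Set Θ) : M.hSet h Set.univ ≤ M.hSet h A := by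
  unfold hSet
  rw [Measure.restrict_univ]
  exact essInf_antitone_measure Measure.absolutelyContinuous_restrict

lemma coe_hSet_univ (hreg : M.Regular h S a ς) :
    (M.hSet h Set.univ : EReal) = ((M.hSet h Set.univ).toReal : EReal) := by
  rw [EReal.coe_ennreal_toReal hreg.hSet_univ_ne_top]

lemma Regular.hSet_univ_lt (hreg : M.Regular h S a ς) : (M.hSet h Set.univ).toReal < ς :=
  (toReal_lt_of_two_mul_lt hreg.rate_gt).2

/-- Eventually the total mass is positive and finite, so that the posterior is a genuine
probability measure. -/
lemma Regular.eventually_mass_univ (hreg : M.Regular h S a ς) :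
    ∀ᵐ ω ∂M.P, ∀ᶠ n : ℕ in atTop,
      M.mass n (M.data n ω) Set.univ ≠ 0 ∧ M.mass n (M.data n ω) Set.univ ≠ ⊤ := by
  set r := (M.hSet h Set.univ).toReal
  have hr := coe_hSet_univ hreg
  filter_upwards [hreg.mass_le MeasurableSet.univ (c := r - 1)
      (by rw [hr]; exact_mod_cast (by linarith)) (by linarith [hreg.hSet_univ_lt]),
    hreg.le_mass MeasurableSet.univ (c := r + 1)
      (by rw [hr]; exact_mod_cast (by linarith))] with ω h1 h2
  filter_upwards [h1, h2] with n hn1 hn2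
  exact ⟨(lt_of_lt_of_le (by simpa using Real.exp_pos _) hn2).ne',
    ne_top_of_le_ne_top ENNReal.ofReal_ne_top hn1⟩

/-- The posterior probability of `A` decays at any rate `c < h(A) - h(Θ)` for which
`c + h(Θ) < ς`. -/
lemma Regular.post_le_exp (hreg : M.Regular h S a ς) {A : Set Θ} (hA : MeasurableSet A) {c : ℝ}
    (hc : ((c + (M.hSet h Set.univ).toReal : ℝ) : EReal) < (M.hSet h A : EReal))
    (hcς : c + (M.hSet h Set.univ).toReal < ς) :
    ∀ᵐ ω ∂M.P, ∀ᶠ n : ℕ in atTop, M.post n (M.data n ω) A ≤ Real.exp (n * -c) := by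
  set r := (M.hSet h Set.univ).toReal
  have hr := coe_hSet_univ hreg
  obtain ⟨b, hb1, hb2⟩ := EReal.lt_iff_exists_real_btwn.1
    (lt_min hc (EReal.coe_lt_coe_iff.2 hcς))
  replace hb1 : c + r < b := EReal.coe_lt_coe_iff.1 hb1
  set b' := (r + (b - c)) / 2 with hb'
  filter_upwards [hreg.mass_le hA (lt_min_iff.1 hb2).1
      (EReal.coe_lt_coe_iff.1 (lt_min_iff.1 hb2).2),
    hreg.le_mass MeasurableSet.univ (c := b')
      (by rw [hr]; exact_mod_cast (by linarith)), ae_data_p_ne] with ω h1 h2 hp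
  filter_upwards [h1, h2, eventually_mul_exp_le 2 (show b' - b < -c by linarith)]
    with n hn1 hn2 hn3
  rw [post_eq_mass_div (hp n).1 (hp n).2]
  refine ENNReal.toReal_le_of_le_ofReal (Real.exp_pos _).le ?_
  calc M.mass n (M.data n ω) A / M.mass n (M.data n ω) Set.univ
      ≤ ENNReal.ofReal (2 * Real.exp (n * -b)) / ENNReal.ofReal (Real.exp (n * -b')) :=
        ENNReal.div_le_div hn1 hn2
    _ = ENNReal.ofReal (2 * Real.exp (n * (b' - b))) := by
        rw [← ENNReal.ofReal_div_of_pos (Real.exp_pos _), mul_div_assoc, ← Real.exp_sub]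
        ring_nf
    _ ≤ _ := ENNReal.ofReal_le_ofReal hn3

/-- The posterior probability of `A` decays at no rate above `h(A) - h(Θ)`. -/
lemma Regular.exp_le_post (hreg : M.Regular h S a ς) {A : Set Θ} (hA : MeasurableSet A) {c : ℝ}
    (hc : (M.hSet h A : EReal) < ((c + (M.hSet h Set.univ).toReal : ℝ) : EReal)) :
    ∀ᵐ ω ∂M.P, ∀ᶠ n : ℕ in atTop, Real.exp (n * -c) ≤ M.post n (M.data n ω) A := by
  set r := (M.hSet h Set.univ).toReal
  have hr := coe_hSet_univ hreg
  obtain ⟨b, hb1, hb2⟩ := EReal.lt_iff_exists_real_btwn.1 hc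
  replace hb2 : b < c + r := EReal.coe_lt_coe_iff.1 hb2
  set b' := (r + (b - c)) / 2 with hb'
  filter_upwards [hreg.le_mass hA hb1,
    hreg.mass_le MeasurableSet.univ (c := b')
      (by rw [hr]; exact_mod_cast (by linarith)) (by linarith [hreg.hSet_univ_lt]),
    ae_data_p_ne, hreg.eventually_mass_univ] with ω h1 h2 hp h3
  filter_upwards [h1, h2, h3, eventually_mul_exp_le 2 (show -c < b' - b by linarith)]
    with n hn1 hn2 hn0 hn3
  have hA_top : M.mass n (M.data n ω) A ≠ ⊤ :=
    ne_top_of_le_ne_top hn0.2 (lintegral_mono_set (Set.subset_univ _))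
  rw [post_eq_mass_div (hp n).1 (hp n).2,
    ← ENNReal.ofReal_le_iff_le_toReal (ENNReal.div_ne_top hA_top hn0.1)]
  calc ENNReal.ofReal (Real.exp (n * -c))
      ≤ ENNReal.ofReal (Real.exp (n * (b' - b)) / 2) :=
        ENNReal.ofReal_le_ofReal (by linarith)
    _ = ENNReal.ofReal (Real.exp (n * -b)) / ENNReal.ofReal (2 * Real.exp (n * -b')) := by
        rw [← ENNReal.ofReal_div_of_pos (by positivity), mul_comm (2 : ℝ), ← div_div,
          ← Real.exp_sub]
        ring_nf
    _ ≤ _ := ENNReal.div_le_div hn1 hn2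

/-- Here `h(A)` need not be below `ς`: the posterior probability of `A` still decays at any rate
below `min (h(A)) ς - h(Θ)`, which is positive. -/
lemma Regular.tendsto_post_zero (hreg : M.Regular h S a ς) {A : Set Θ} (hA : MeasurableSet A)
    (hlt : M.hSet h Set.univ < M.hSet h A) :
    ∀ᵐ ω ∂M.P, Tendsto (fun n => M.post n (M.data n ω) A) atTop (𝓝 0) := by
  set r := (M.hSet h Set.univ).toReal
  have hr := coe_hSet_univ hreg
  have h1 : (r : EReal) < min (M.hSet h A : EReal) (ς : EReal) := by
    refine lt_min ?_ (EReal.coe_lt_coe_iff.2 hreg.hSet_univ_lt)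
    rw [← hr]
    exact_mod_cast hlt
  obtain ⟨b, hb1, hb2⟩ := EReal.lt_iff_exists_real_btwn.1 h1
  replace hb1 : r < b := EReal.coe_lt_coe_iff.1 hb1
  filter_upwards [hreg.post_le_exp hA (c := b - r)
    (by rw [sub_add_cancel]; exact (lt_min_iff.1 hb2).1)
    (by rw [sub_add_cancel]; exact EReal.coe_lt_coe_iff.1 (lt_min_iff.1 hb2).2)] with ω hω
  exact tendsto_of_tendsto_of_tendsto_of_le_of_le' tendsto_const_nhds
    (tendsto_exp_nat_mul_of_neg (by linarith)) (Eventually.of_forall fun n => post_nonneg _ _ _) hω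

lemma Regular.J_eq (hreg : M.Regular h S a ς) (A : Set Θ) :
    M.J h A = (M.hSet h A : EReal) - ((M.hSet h Set.univ).toReal : EReal) := by
  have hr := coe_hSet_univ hreg
  set r := (M.hSet h Set.univ).toReal
  apply le_antisymm
  · have h1 : ∀ᵐ θ ∂M.prior.restrict A, M.J h A + (r : EReal) ≤ (h θ : EReal) := by
      filter_upwards [ae_essInf_le (f := fun θ => (h θ : EReal) - (M.hSet h Set.univ : EReal))
        (μ := M.prior.restrict A)] with θ hθ
      have h4 : M.J h A ≤ (h θ : EReal) - (r : EReal) := by rw [← hr]; exact hθ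
      exact EReal.add_le_of_le_sub h4
    exact EReal.le_sub_iff_add_le (by simp) (by simp) |>.2 (le_coe_hSet h1)
  · refine le_essInf_of_ae_le _ ?_
    filter_upwards [ae_essInf_le (f := h) (μ := M.prior.restrict A)] with θ hθ
    rw [hr]
    exact EReal.sub_le_sub (by exact_mod_cast hθ) le_rfl

/-- A bounded function of the data that tends to `0` almost surely tends to `0` in mean. -/
lemma tendsto_integral_law_zero {F : (n : ℕ) → (Fin n → Ξ) → ℝ} {C : ℝ}
    (hm : ∀ n, AEMeasurable (F n) (M.law n)) (hC : ∀ n x, |F n x| ≤ C)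
    (hF : ∀ᵐ ω ∂M.P, Tendsto (fun n => F n (M.data n ω)) atTop (𝓝 0)) :
    Tendsto (fun n => ∫ x, F n x ∂M.law n) atTop (𝓝 0) := by
  have h1 : ∀ n, ∫ x, F n x ∂M.law n = ∫ ω, F n (M.data n ω) ∂M.P := fun n =>
    integral_map (M.measurable_data n).aemeasurable (hm n).aestronglyMeasurable
  simp_rw [h1]
  have h2 := tendsto_integral_of_dominated_convergence (μ := M.P) (f := fun _ => 0) (fun _ => C)
    (F := fun n ω => F n (M.data n ω))
    (fun n => ((hm n).comp_measurable (M.measurable_data n)).aestronglyMeasurable)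
    (integrable_const C) (fun n => Eventually.of_forall fun ω => hC n _) hF
  simpa using h2

end BayesModel

/-! ### Almost sure bounds from rates -/

/-- The exceptional null set may depend on the rate `c`, since rational rates suffice. -/
lemma ae_limsup_le_neg {Ω : Type*} [MeasurableSpace Ω] {μ : Measure Ω} {X : ℕ → Ω → EReal}
    {L : EReal} (hX : ∀ c : ℝ, (c : EReal) < L →
      ∀ᵐ ω ∂μ, ∀ᶠ n in atTop, X n ω ≤ ((-c : ℝ) : EReal)) :
    ∀ᵐ ω ∂μ, limsup (fun n => X n ω) atTop ≤ -L := by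
  have h1 : ∀ᵐ ω ∂μ, ∀ q : ℚ, (((q : ℝ) : EReal) < L →
      ∀ᶠ n in atTop, X n ω ≤ ((-(q : ℝ) : ℝ) : EReal)) := by
    rw [ae_all_iff]
    intro q
    by_cases hq : ((q : ℝ) : EReal) < L
    · filter_upwards [hX q hq] with ω hω using fun _ => hω
    · exact Eventually.of_forall fun _ h => absurd h hq
  filter_upwards [h1] with ω hω
  rw [← EReal.le_neg]
  by_contra! hlt
  obtain ⟨q, hq1, hq2⟩ := EReal.lt_iff_exists_rat_btwn.1 hlt
  have h2 : limsup (fun n => X n ω) atTop ≤ ((-(q : ℝ) : ℝ) : EReal) :=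
    limsup_le_of_le (h := hω q hq2)
  rw [EReal.coe_neg, ← EReal.le_neg] at h2
  exact absurd hq1 (not_lt.2 h2)

/-- Lower counterpart of `ae_limsup_le_neg`. -/
lemma ae_neg_le_liminf {Ω : Type*} [MeasurableSpace Ω] {μ : Measure Ω} {X : ℕ → Ω → EReal}
    {L : EReal} (hX : ∀ c : ℝ, L < (c : EReal) →
      ∀ᵐ ω ∂μ, ∀ᶠ n in atTop, ((-c : ℝ) : EReal) ≤ X n ω) :
    ∀ᵐ ω ∂μ, -L ≤ liminf (fun n => X n ω) atTop := by
  have h1 : ∀ᵐ ω ∂μ, ∀ q : ℚ, (L < ((q : ℝ) : EReal) →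
      ∀ᶠ n in atTop, ((-(q : ℝ) : ℝ) : EReal) ≤ X n ω) := by
    rw [ae_all_iff]
    intro q
    by_cases hq : L < ((q : ℝ) : EReal)
    · filter_upwards [hX q hq] with ω hω using fun _ => hω
    · exact Eventually.of_forall fun _ h => absurd h hq
  filter_upwards [h1] with ω hω
  rw [EReal.neg_le]
  by_contra! hlt
  obtain ⟨q, hq1, hq2⟩ := EReal.lt_iff_exists_rat_btwn.1 hlt
  have h2 : ((-(q : ℝ) : ℝ) : EReal) ≤ liminf (fun n => X n ω) atTop :=
    le_liminf_of_le (h := hω q hq1)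
  rw [EReal.coe_neg, EReal.neg_le] at h2
  exact absurd hq2 (not_lt.2 h2)

/-! ### Decisions and posterior probabilities of hypotheses -/

lemma ind_nonneg (b : Bool) : 0 ≤ ind b := by cases b <;> simp [ind]

lemma ind_le_one (b : Bool) : ind b ≤ 1 := by cases b <;> simp [ind]

namespace BayesModel

variable {Ω Ξ Θ : Type*} [MeasurableSpace Ω] [MeasurableSpace Ξ] [MeasurableSpace Θ]
  {M : BayesModel Ω Ξ Θ}

lemma post_add_post_le_one {n : ℕ} {x : Fin n → Ξ} {A B : Set Θ} (hB : MeasurableSet B)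
    (hAB : Disjoint A B) : M.post n x A + M.post n x B ≤ 1 := by
  have hfin : ∀ A, (∫⁻ θ in A, M.f n θ x ∂M.prior) / ∫⁻ θ, M.f n θ x ∂M.prior ≠ ⊤ := fun A =>
    ne_top_of_le_ne_top ENNReal.one_ne_top
      (ENNReal.div_le_of_le_mul (by rw [one_mul]; exact setLIntegral_le_lintegral _ _))
  calc M.post n x A + M.post n x B = M.post n x (A ∪ B) := by
        rw [post, post, post, ← ENNReal.toReal_add (hfin A) (hfin B), ← ENNReal.add_div,
          ← lintegral_union hB hAB]
    _ ≤ 1 := post_le_one _ _ _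

lemma one_le_sum_post {κ : Type*} [Fintype κ] {n : ℕ} {x : Fin n → Ξ} (h0 : M.p n x ≠ 0)
    (h1 : M.p n x ≠ ⊤) (hm0 : M.mass n x Set.univ ≠ 0) (hm1 : M.mass n x Set.univ ≠ ⊤)
    {A : κ → Set Θ} (hA : ⋃ k, A k = Set.univ) : 1 ≤ ∑ k, M.post n x (A k) := by
  have hfin : ∀ k, M.mass n x (A k) / M.mass n x Set.univ ≠ ⊤ := fun k =>
    ENNReal.div_ne_top (ne_top_of_le_ne_top hm1 (lintegral_mono_set (Set.subset_univ _))) hm0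
  simp_rw [post_eq_mass_div h0 h1]
  rw [← ENNReal.toReal_sum fun k _ => hfin k, ← ENNReal.toReal_one]
  refine ENNReal.toReal_mono (ENNReal.sum_ne_top.2 fun k _ => hfin k) ?_
  simp_rw [div_eq_mul_inv]
  rw [← Finset.sum_mul, ← ENNReal.mul_inv_cancel hm0 hm1]
  gcongr
  have := lintegral_iUnion_le (μ := M.prior) A (fun θ => M.ratio n θ x)
  rwa [hA, tsum_fintype] at this

end BayesModel

namespace TestingProblem

variable {ι : Type*} {T : ι → Type*} [∀ k, MeasurableSpace (T k)] {m : ℕ}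
  {H : TestingProblem T m}

lemma measurableSet_hyp (i : Fin m) (b : Bool) : MeasurableSet (H.hyp i b) := by
  have h1 : MeasurableSet {θ : (k : ι) → T k | θ (H.coord i) ∈ H.alt i} :=
    measurable_pi_apply _ (H.measurable_alt i)
  cases b
  · convert h1.compl using 1
    ext θ
    simp [hyp]
  · convert h1 using 1
    ext θ
    simp [hyp]

lemma measurableSet_cell (d : Config m) : MeasurableSet (H.cell d) :=
  MeasurableSet.iInter fun i => measurableSet_hyp i _

lemma iUnion_cell : ⋃ d, H.cell d = Set.univ := by
  classical
  refine Set.eq_univ_of_forall fun θ => Set.mem_iUnion.2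
    ⟨fun i => decide (θ (H.coord i) ∈ H.alt i), ?_⟩
  simp [cell, hyp]

lemma disjoint_hyp_cell {dt : Config m} {i : Fin m} (hi : dt i = false) :
    Disjoint (H.hyp i true) (H.cell dt) := by
  rw [Set.disjoint_left]
  intro θ h1 h2
  have h3 := Set.mem_iInter.1 h2 i
  simp only [hyp, hi, Set.mem_ofPred_eq, Bool.false_eq_true, iff_false, iff_true] at h1 h3
  exact h3 h1

lemma cell_subset_groupCell {dt : Config m} {i : Fin m} (hi : dt i = true) :
    H.cell dt ⊆ H.groupCell i dt := by
  intro θ hθ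
  refine ⟨?_, Set.mem_iInter₂.2 fun j _ => Set.mem_iInter.1 hθ j⟩
  have := Set.mem_iInter.1 hθ i
  rwa [hi] at this

variable {Ω Ξ : Type*} [MeasurableSpace Ω] [MeasurableSpace Ξ]
  {M : BayesModel Ω Ξ ((k : ι) → T k)} {n : ℕ} {x : Fin n → Ξ} {dt d : Config m}

lemma w_nonneg (i : Fin m) : 0 ≤ H.w M n x i d := BayesModel.post_nonneg _ _ _

lemma w_le_one (i : Fin m) : H.w M n x i d ≤ 1 := BayesModel.post_le_one _ _ _

lemma v_nonneg (i : Fin m) : 0 ≤ H.v M n x i := BayesModel.post_nonneg _ _ _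

lemma v_le_one (i : Fin m) : H.v M n x i ≤ 1 := BayesModel.post_le_one _ _ _

lemma w_le_v (i : Fin m) : H.w M n x i d ≤ H.v M n x i :=
  BayesModel.post_mono Set.inter_subset_left

lemma v_le_of_null {i : Fin m} (hi : dt i = false) :
    H.v M n x i ≤ 1 - M.post n x (H.cell dt) := by
  have := BayesModel.post_add_post_le_one (M := M) (n := n) (x := x)
    (measurableSet_cell (H := H) dt) (disjoint_hyp_cell hi)
  unfold v
  linarith

lemma le_w_of_signal {i : Fin m} (hi : dt i = true) :
    M.post n x (H.cell dt) ≤ H.w M n x i dt :=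
  BayesModel.post_mono (cell_subset_groupCell hi)

/-! ### Maximizers of the criterion -/

/-- A decision that beats the true configuration `dt` is termwise almost as good as `dt`: the
termwise upper bounds `ind (dt i) * (1 - β) + ε`, where `ε` is the posterior probability that
`dt` is wrong, exceed the criterion of `dt`, hence that of `d`, by at most `2 m ε` in total. -/
lemma criterion_gap_le {β : ℝ} (hβ : β ∈ Set.Icc (0 : ℝ) 1)
    (hmax : H.criterion M n x β dt ≤ H.criterion M n x β d) (i : Fin m) :
    ind (dt i) * (1 - β) + (1 - M.post n x (H.cell dt)) - ind (d i) * (H.w M n x i d - β) ≤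
      2 * m * (1 - M.post n x (H.cell dt)) := by
  set ε := 1 - M.post n x (H.cell dt) with hε
  have hε0 : 0 ≤ ε := by linarith [BayesModel.post_le_one (M := M) n x (H.cell dt)]
  set g : Fin m → ℝ := fun i =>
    ind (dt i) * (1 - β) + ε - ind (d i) * (H.w M n x i d - β)
  have hg : ∀ i, 0 ≤ g i := by
    intro i
    have h1 := w_le_one (H := H) (M := M) (n := n) (x := x) (d := d) i
    have h3 := hβ.1
    have h4 := hβ.2
    cases hdi : d i <;> cases hti : dt i <;> simp only [g, hdi, hti, ind] <;> simp
    · exact hε0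
    · linarith
    · have h2 := w_le_v (H := H) (M := M) (n := n) (x := x) (d := d) i
      have h5 := v_le_of_null (H := H) (M := M) (n := n) (x := x) hti
      linarith
    · linarith
  have hdt : ∑ i, (ind (dt i) * (1 - β) - ε) ≤ H.criterion M n x β dt := by
    refine Finset.sum_le_sum fun i _ => ?_
    cases hti : dt i <;> simp [ind]
    · exact hε0
    · have := le_w_of_signal (H := H) (M := M) (n := n) (x := x) hti
      linarith
  calc g i ≤ ∑ j, g j := Finset.single_le_sum (fun j _ => hg j) (Finset.mem_univ i)
    _ = ∑ j, (ind (dt j) * (1 - β) - ε) + 2 * m * ε - H.criterion M n x β d := by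
        simp only [g, criterion, Finset.sum_sub_distrib, Finset.sum_add_distrib,
          Finset.sum_const, Finset.card_univ, Fintype.card_fin, nsmul_eq_mul]
        ring
    _ ≤ 2 * m * ε := by linarith

lemma reject_of_signal {β : ℝ} (hβ : β ∈ Set.Icc (0 : ℝ) 1)
    (hmax : H.criterion M n x β dt ≤ H.criterion M n x β d)
    (hε : 2 * m * (1 - M.post n x (H.cell dt)) < 1 - β) {i : Fin m} (hi : dt i = true) :
    d i = true := by
  by_contra hd
  have h1 := criterion_gap_le hβ hmax i
  have h2 := BayesModel.post_le_one (M := M) n x (H.cell dt)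
  simp only [hi, Bool.eq_false_iff.2 hd, ind] at h1
  simp at h1
  linarith

lemma accept_of_null {β : ℝ} (hβ : β ∈ Set.Icc (0 : ℝ) 1)
    (hmax : H.criterion M n x β dt ≤ H.criterion M n x β d)
    (hε : 2 * m * (1 - M.post n x (H.cell dt)) < β) {i : Fin m} (hi : dt i = false) :
    d i = false := by
  by_contra hd
  have h1 := criterion_gap_le hβ hmax i
  have h2 := w_le_v (H := H) (M := M) (n := n) (x := x) (d := d) i
  have h3 := v_le_of_null (H := H) (M := M) (n := n) (x := x) hi
  simp only [hi, Bool.not_eq_false _ ▸ hd, ind] at h1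
  simp at h1
  linarith

/-! ### Posterior error rates -/

/-- `∑ v_{in}` over the true null hypotheses. -/
noncomputable def nullMass (H : TestingProblem T m) (M : BayesModel Ω Ξ ((k : ι) → T k))
    (dt : Config m) (n : ℕ) (x : Fin n → Ξ) : ℝ :=
  ∑ i with dt i = false, H.v M n x i

lemma nullMass_nonneg : 0 ≤ H.nullMass M dt n x :=
  Finset.sum_nonneg fun i _ => v_nonneg i

lemma nullMass_le : H.nullMass M dt n x ≤ m * (1 - M.post n x (H.cell dt)) := by
  have h2 := BayesModel.post_le_one (M := M) n x (H.cell dt)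
  calc H.nullMass M dt n x ≤ ∑ i with dt i = false, (1 - M.post n x (H.cell dt)) :=
        Finset.sum_le_sum fun i hi => v_le_of_null (Finset.mem_filter.1 hi).2
    _ ≤ ∑ i, (1 - M.post n x (H.cell dt)) :=
        Finset.sum_le_sum_of_subset_of_nonneg (Finset.filter_subset _ _)
          fun _ _ _ => by linarith
    _ = _ := by rw [Finset.sum_const, Finset.card_univ, Fintype.card_fin, nsmul_eq_mul]

lemma FNR_nonneg : 0 ≤ H.FNR M n x d :=
  div_nonneg (Finset.sum_nonneg fun i _ =>
    mul_nonneg (by linarith [ind_le_one (d i)]) (v_nonneg i)) (by positivity)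

lemma FNR_le_one : H.FNR M n x d ≤ 1 := by
  refine div_le_one_of_le₀ (le_max_of_le_left (Finset.sum_le_sum fun i _ => ?_)) (by positivity)
  exact mul_le_of_le_one_right (by linarith [ind_le_one (d i)]) (v_le_one i)

lemma FNR_le_nullMass (hd : ∀ i, dt i = true → d i = true) :
    H.FNR M n x d ≤ H.nullMass M dt n x := by
  refine div_le_of_le_mul₀ (by positivity) nullMass_nonneg ?_
  refine le_trans ?_ (le_mul_of_one_le_right nullMass_nonneg (le_max_right _ _))
  rw [nullMass, Finset.sum_filter]
  refine Finset.sum_le_sum fun i _ => ?_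
  have := v_nonneg (H := H) (M := M) (n := n) (x := x) i
  cases hi : dt i
  · simpa using mul_le_of_le_one_left this (by linarith [ind_nonneg (d i)])
  · simp [hd i hi, ind]

lemma v_div_le_FNR {i : Fin m} (hi : d i = false) :
    H.v M n x i / m ≤ H.FNR M n x d := by
  have hm : (1 : ℝ) ≤ m := by exact_mod_cast Nat.one_le_of_lt i.2
  have h1 : max (∑ i, (1 - ind (d i))) 1 ≤ (m : ℝ) := by
    refine max_le ?_ hm
    calc ∑ i, (1 - ind (d i)) ≤ ∑ _i : Fin m, (1 : ℝ) :=
          Finset.sum_le_sum fun i _ => by linarith [ind_nonneg (d i)]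
      _ = m := by simp
  have h2 : H.v M n x i ≤ ∑ i, (1 - ind (d i)) * H.v M n x i := by
    have := Finset.single_le_sum (f := fun i => (1 - ind (d i)) * H.v M n x i)
      (fun j _ => mul_nonneg (by linarith [ind_le_one (d j)]) (v_nonneg j)) (Finset.mem_univ i)
    simpa [hi, ind] using this
  exact div_le_div₀ ((v_nonneg i).trans h2) h2 (by positivity) h1

lemma mFDR_nonneg : 0 ≤ H.mFDR M n x d :=
  div_nonneg (Finset.sum_nonneg fun i _ =>
    mul_nonneg (ind_nonneg _)
      (by linarith [w_le_one (H := H) (M := M) (n := n) (x := x) (d := d) i]))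
    (by positivity)

lemma mFDR_le_one : H.mFDR M n x d ≤ 1 := by
  refine div_le_one_of_le₀ (le_max_of_le_left (Finset.sum_le_sum fun i _ => ?_)) (by positivity)
  exact mul_le_of_le_one_right (ind_nonneg _)
    (by linarith [w_nonneg (H := H) (M := M) (n := n) (x := x) (d := d) i])

/-- A maximizer of the criterion with constant `β` has modified posterior FDR at most `1 - β`,
since its criterion is at least that of rejecting nothing. -/
lemma mFDR_le_one_sub {β : ℝ} (hβ : β ≤ 1)
    (hmax : H.criterion M n x β (fun _ => false) ≤ H.criterion M n x β d) :
    H.mFDR M n x d ≤ 1 - β := by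
  have h1 : 0 ≤ ∑ i, ind (d i) * (H.w M n x i d - β) := by
    simpa [criterion, ind] using hmax
  refine div_le_of_le_mul₀ (by positivity) (by linarith) ?_
  calc ∑ i, ind (d i) * (1 - H.w M n x i d)
      = (1 - β) * (∑ i, ind (d i)) - ∑ i, ind (d i) * (H.w M n x i d - β) := by
        rw [Finset.mul_sum, ← Finset.sum_sub_distrib]
        exact Finset.sum_congr rfl fun i _ => by ring
    _ ≤ (1 - β) * (∑ i, ind (d i)) := by linarith
    _ ≤ (1 - β) * max (∑ i, ind (d i)) 1 := by
        have := sub_nonneg.2 hβ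
        gcongr
        exact le_max_left _ _

/-- Rejecting everything has modified posterior FDR close to the proportion of true nulls. -/
lemma le_mFDR_all (hm : 0 < m) :
    ((Finset.univ.filter fun i => dt i = false).card : ℝ) / m - H.nullMass M dt n x ≤
      H.mFDR M n x (fun _ => true) := by
  have hm1 : (1 : ℝ) ≤ m := by exact_mod_cast hm
  have h1 : ∑ i with dt i = false, (1 - H.v M n x i) ≤
      ∑ i, (1 - H.w M n x i (fun _ => true)) :=
    calc ∑ i with dt i = false, (1 - H.v M n x i)
        ≤ ∑ i with dt i = false, (1 - H.w M n x i (fun _ => true)) :=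
          Finset.sum_le_sum fun i _ => by
            linarith [w_le_v (H := H) (M := M) (n := n) (x := x) (d := fun _ => true) i]
      _ ≤ _ := Finset.sum_le_sum_of_subset_of_nonneg (Finset.filter_subset _ _) fun i _ _ => by
            linarith [w_le_one (H := H) (M := M) (n := n) (x := x) (d := fun _ => true) i]
  have h2 : H.mFDR M n x (fun _ => true) = (∑ i, (1 - H.w M n x i (fun _ => true))) / m := by
    simp [mFDR, ind, hm1]
  rw [h2]
  calc _ ≤ ((Finset.univ.filter fun i => dt i = false).card : ℝ) / m - H.nullMass M dt n x / m := by
        gcongr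
        exact div_le_self nullMass_nonneg hm1
    _ = (∑ i with dt i = false, (1 - H.v M n x i)) / m := by
        rw [Finset.sum_sub_distrib, sub_div, nullMass]; simp
    _ ≤ _ := by gcongr

/-! ### Measurability -/

/-- A measurable decision takes finitely many values, so it may be substituted into a function
that is a.e. measurable for every fixed decision. -/
lemma aemeasurable_comp_config {α : Type*} [MeasurableSpace α] {μ : Measure α}
    {F : α → Config m → ℝ} (hF : ∀ d, AEMeasurable (fun x => F x d) μ)
    {D : α → Config m} (hD : Measurable D) : AEMeasurable (fun x => F x (D x)) μ := by
  refine ⟨fun x => (hF (D x)).mk _ x, ?_, ?_⟩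
  · have h1 : Measurable (fun z : α × Config m => (hF z.2).mk _ z.1) :=
      measurable_from_prod_countable_left fun d => (hF d).measurable_mk
    exact h1.comp (measurable_id.prodMk hD)
  · filter_upwards [ae_all_iff.2 fun d => (hF d).ae_eq_mk] with x hx using hx (D x)

variable {h : ((k : ι) → T k) → ℝ≥0∞} {S : ℕ → Set ((k : ι) → T k)} {a ς : ℝ}

lemma aemeasurable_FNR (hreg : M.Regular h S a ς) {D : (Fin n → Ξ) → Config m}
    (hD : Measurable D) : AEMeasurable (fun x => H.FNR M n x (D x)) (M.law n) := by
  refine aemeasurable_comp_config (fun d => ?_) hD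
  refine AEMeasurable.div_const (Finset.aemeasurable_fun_sum _ fun i _ => ?_) _
  exact (hreg.aemeasurable_post n _).const_mul _

lemma aemeasurable_mFDR (hreg : M.Regular h S a ς) {D : (Fin n → Ξ) → Config m}
    (hD : Measurable D) : AEMeasurable (fun x => H.mFDR M n x (D x)) (M.law n) := by
  refine aemeasurable_comp_config (fun d => ?_) hD
  refine AEMeasurable.div_const (Finset.aemeasurable_fun_sum _ fun i _ => ?_) _
  exact ((hreg.aemeasurable_post n _).const_sub _).const_mul _

lemma aemeasurable_nullMass (hreg : M.Regular h S a ς) :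
    AEMeasurable (fun x => H.nullMass M dt n x) (M.law n) :=
  Finset.aemeasurable_fun_sum _ fun _ _ => hreg.aemeasurable_post n _

/-! ### Almost sure asymptotics -/

/-- The posterior concentrates on the true configuration. -/
lemma IsTrueConfig.tendsto_post_cell (hdt : H.IsTrueConfig M h dt) (hreg : M.Regular h S a ς) :
    ∀ᵐ ω ∂M.P, Tendsto (fun n => 1 - M.post n (M.data n ω) (H.cell dt)) atTop (𝓝 0) := by
  have h1 : ∀ᵐ ω ∂M.P, ∀ d, d ≠ dt →
      Tendsto (fun n => M.post n (M.data n ω) (H.cell d)) atTop (𝓝 0) := by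
    rw [ae_all_iff]
    intro d
    by_cases hd : d = dt
    · simp [hd]
    · have hlt : M.hSet h Set.univ < M.hSet h (H.cell d) := by
        refine lt_of_le_of_ne (BayesModel.hSet_univ_le _) fun heq => hd (hdt.2 d ?_)
        rw [hreg.J_eq, hreg.J_eq, ← heq]
      filter_upwards [hreg.tendsto_post_zero (measurableSet_cell d) hlt] with ω hω _ using hω
  filter_upwards [h1, hreg.eventually_mass_univ, BayesModel.ae_data_p_ne] with ω hω hm hp
  have hsum : Tendsto (fun n => ∑ d ∈ Finset.univ.erase dt, M.post n (M.data n ω) (H.cell d))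
      atTop (𝓝 0) := by
    have := tendsto_finsetSum (Finset.univ.erase dt)
      (fun d hd => hω d (Finset.ne_of_mem_erase hd))
    simpa using this
  refine tendsto_of_tendsto_of_tendsto_of_le_of_le' tendsto_const_nhds hsum
    (Eventually.of_forall fun n => by
      linarith [BayesModel.post_le_one (M := M) n (M.data n ω) (H.cell dt)]) ?_
  filter_upwards [hm] with n hn
  have h2 := BayesModel.one_le_sum_post (hp n).1 (hp n).2 hn.1 hn.2 (iUnion_cell (H := H))
  rw [← Finset.add_sum_erase _ _ (Finset.mem_univ dt)] at h2
  linarith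

lemma IsTrueConfig.tendsto_nullMass (hdt : H.IsTrueConfig M h dt) (hreg : M.Regular h S a ς) :
    ∀ᵐ ω ∂M.P, Tendsto (fun n => H.nullMass M dt n (M.data n ω)) atTop (𝓝 0) := by
  filter_upwards [hdt.tendsto_post_cell hreg] with ω hω
  have h1 := hω.const_mul (m : ℝ)
  rw [mul_zero] at h1
  exact squeeze_zero (fun n => nullMass_nonneg) (fun n => nullMass_le) h1

/-- If the penalizing constants stay away from `1`, all false nulls are eventually rejected. -/
lemma IsTrueConfig.eventually_reject (hdt : H.IsTrueConfig M h dt) (hreg : M.Regular h S a ς)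
    {β : ℕ → ℝ} (hβ : ∀ n, β n ∈ Set.Icc (0 : ℝ) 1) {b : ℝ} (hb : b < 1)
    (hβb : ∀ᶠ n in atTop, β n ≤ b) {dhat : (n : ℕ) → (Fin n → Ξ) → Config m}
    (hdhat : H.IsNonMarginal M β dhat) :
    ∀ᵐ ω ∂M.P, ∀ᶠ n in atTop, ∀ i, dt i = true → dhat n (M.data n ω) i = true := by
  filter_upwards [hdt.tendsto_post_cell hreg] with ω hω
  have h1 := hω.const_mul (2 * m : ℝ)
  rw [mul_zero] at h1
  filter_upwards [h1.eventually_lt_const (sub_pos.2 hb), hβb] with n hn hbn i hi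
  exact reject_of_signal (hβ n) ((hdhat n).2 _ _) (by linarith) hi

/-- If the penalizing constants stay away from `0`, all true nulls are eventually accepted. -/
lemma IsTrueConfig.eventually_accept (hdt : H.IsTrueConfig M h dt) (hreg : M.Regular h S a ς)
    {β : ℕ → ℝ} (hβ : ∀ n, β n ∈ Set.Icc (0 : ℝ) 1) {b : ℝ} (hb : 0 < b)
    (hβb : ∀ᶠ n in atTop, b < β n) {dhat : (n : ℕ) → (Fin n → Ξ) → Config m}
    (hdhat : H.IsNonMarginal M β dhat) :
    ∀ᵐ ω ∂M.P, ∀ᶠ n in atTop, ∀ i, dt i = false → dhat n (M.data n ω) i = false := by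
  filter_upwards [hdt.tendsto_post_cell hreg] with ω hω
  have h1 := hω.const_mul (2 * m : ℝ)
  rw [mul_zero] at h1
  filter_upwards [h1.eventually_lt_const hb, hβb] with n hn hbn i hi
  exact accept_of_null (hβ n) ((hdhat n).2 _ _) (by linarith) hi

lemma v_le_exp (hreg : M.Regular h S a ς) {i : Fin m}
    (hς : M.prior (H.hyp i true) ≠ 0 → 2 * M.hSet h (H.hyp i true) < ENNReal.ofReal ς)
    {c : ℝ} (hc : (c : EReal) < M.J h (H.hyp i true)) :
    ∀ᵐ ω ∂M.P, ∀ᶠ n : ℕ in atTop, H.v M n (M.data n ω) i ≤ Real.exp (n * -c) := by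
  by_cases h0 : M.prior (H.hyp i true) = 0
  · refine Eventually.of_forall fun ω => Eventually.of_forall fun n => ?_
    have : H.v M n (M.data n ω) i = 0 := by
      simp [v, BayesModel.post, Measure.restrict_eq_zero.2 h0]
    rw [this]
    exact (Real.exp_pos _).le
  · obtain ⟨htop, hlt⟩ := BayesModel.toReal_lt_of_two_mul_lt (hς h0)
    rw [hreg.J_eq, ← EReal.coe_ennreal_toReal htop, ← EReal.coe_sub, EReal.coe_lt_coe_iff] at hc
    refine hreg.post_le_exp (measurableSet_hyp i true) ?_ (by linarith)
    rw [← EReal.coe_ennreal_toReal htop, EReal.coe_lt_coe_iff]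
    linarith

lemma exp_le_v (hreg : M.Regular h S a ς) {i : Fin m}
    {c : ℝ} (hc : M.J h (H.hyp i true) < (c : EReal)) :
    ∀ᵐ ω ∂M.P, ∀ᶠ n : ℕ in atTop, Real.exp (n * -c) ≤ H.v M n (M.data n ω) i := by
  refine hreg.exp_le_post (measurableSet_hyp i true) ?_
  rw [hreg.J_eq] at hc
  have htop : M.hSet h (H.hyp i true) ≠ ⊤ := by
    intro h0
    rw [h0] at hc
    simp at hc
  rw [← EReal.coe_ennreal_toReal htop, ← EReal.coe_sub, EReal.coe_lt_coe_iff] at hc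
  rw [← EReal.coe_ennreal_toReal htop, EReal.coe_lt_coe_iff]
  linarith

lemma ae_nullMass_le_exp (hreg : M.Regular h S a ς)
    (hς : ∀ i, dt i = false → M.prior (H.hyp i true) ≠ 0 →
      2 * M.hSet h (H.hyp i true) < ENNReal.ofReal ς)
    {c : ℝ} (hc : (c : EReal) < H.HtildeMin M h dt) :
    ∀ᵐ ω ∂M.P, ∀ᶠ n : ℕ in atTop, H.nullMass M dt n (M.data n ω) ≤ Real.exp (n * -c) := by
  obtain ⟨b, hcb, hb⟩ := EReal.lt_iff_exists_real_btwn.1 hc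
  replace hcb : c < b := EReal.coe_lt_coe_iff.1 hcb
  have h1 : ∀ᵐ ω ∂M.P, ∀ i, dt i = false →
      ∀ᶠ n : ℕ in atTop, H.v M n (M.data n ω) i ≤ Real.exp (n * -b) := by
    rw [ae_all_iff]
    intro i
    by_cases hi : dt i = false
    · have hbi : (b : EReal) < M.J h (H.hyp i true) :=
        hb.trans_le (iInf_le (fun i : {i : Fin m // dt i = false} => M.J h (H.hyp i true)) ⟨i, hi⟩)
      exact (v_le_exp hreg (hς i hi) hbi).mono fun ω hω _ => hω
    · exact Eventually.of_forall fun ω hi' => absurd hi' hi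
  filter_upwards [h1] with ω hω
  have h2 : ∀ᶠ n : ℕ in atTop, ∀ i, dt i = false → H.v M n (M.data n ω) i ≤ Real.exp (n * -b) := by
    rw [eventually_all]
    intro i
    by_cases hi : dt i = false
    · exact (hω i hi).mono fun n hn _ => hn
    · exact Eventually.of_forall fun n hi' => absurd hi' hi
  filter_upwards [h2, eventually_mul_exp_le m (show -b < -c by linarith)] with n hn hn2
  refine le_trans ?_ hn2
  calc H.nullMass M dt n (M.data n ω) ≤ ∑ i with dt i = false, Real.exp (n * -b) :=
        Finset.sum_le_sum fun i hi => hn i (Finset.mem_filter.1 hi).2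
    _ ≤ ∑ _i : Fin m, Real.exp (n * -b) :=
        Finset.sum_le_sum_of_subset_of_nonneg (Finset.filter_subset _ _)
          fun _ _ _ => (Real.exp_pos _).le
    _ = _ := by simp

lemma ae_limsup_logFNR_le (hreg : M.Regular h S a ς)
    (hς : ∀ i, dt i = false → M.prior (H.hyp i true) ≠ 0 →
      2 * M.hSet h (H.hyp i true) < ENNReal.ofReal ς)
    {dhat : (n : ℕ) → (Fin n → Ξ) → Config m}
    (hrej : ∀ᵐ ω ∂M.P, ∀ᶠ n in atTop, ∀ i, dt i = true → dhat n (M.data n ω) i = true) :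
    ∀ᵐ ω ∂M.P, limsup (fun n => H.logFNR M dhat n ω) atTop ≤ -H.HtildeMin M h dt := by
  refine ae_limsup_le_neg fun c hc => ?_
  filter_upwards [hrej, ae_nullMass_le_exp hreg hς hc] with ω h1 h2
  filter_upwards [h1, h2, eventually_gt_atTop 0] with n hn1 hn2 hn
  rw [logFNR, log_div_le_iff hn]
  exact ENNReal.ofReal_le_ofReal ((FNR_le_nullMass hn1).trans hn2)

lemma ae_le_liminf_logFNR (hreg : M.Regular h S a ς)
    {dhat : (n : ℕ) → (Fin n → Ξ) → Config m}
    (hacc : ∀ᵐ ω ∂M.P, ∀ᶠ n in atTop, ∀ i, dt i = false → dhat n (M.data n ω) i = false) :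
    ∀ᵐ ω ∂M.P, -H.HtildeMin M h dt ≤ liminf (fun n => H.logFNR M dhat n ω) atTop := by
  refine ae_neg_le_liminf fun c hc => ?_
  obtain ⟨⟨i, hi⟩, hic⟩ := iInf_lt_iff.1 hc
  obtain ⟨b, hb, hbc⟩ := EReal.lt_iff_exists_real_btwn.1 hic
  replace hbc : b < c := EReal.coe_lt_coe_iff.1 hbc
  have hm : (0 : ℝ) < m := by exact_mod_cast (Nat.zero_le _).trans_lt i.2
  filter_upwards [hacc, exp_le_v hreg hb] with ω h1 h2
  filter_upwards [h1, h2, eventually_gt_atTop 0,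
    eventually_mul_exp_le m (show -c < -b by linarith)] with n hn1 hn2 hn hn3
  rw [logFNR, le_log_div_iff hn]
  refine ENNReal.ofReal_le_ofReal (le_trans ?_ (v_div_le_FNR (hn1 i hi)))
  rw [le_div_iff₀ hm]
  linarith

/-! ### Expected error rates -/

/-- Conditioning on a set does not decrease the integral of a nonnegative function over it. -/
lemma setIntegral_le_integral_cond {α : Type*} [MeasurableSpace α] {μ : Measure α}
    [IsProbabilityMeasure μ] {s : Set α} {F : α → ℝ} (hF : ∀ x, 0 ≤ F x) :
    ∫ x in s, F x ∂μ ≤ ∫ x, F x ∂μ[|s] := by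
  have hI : 0 ≤ ∫ x in s, F x ∂μ := integral_nonneg hF
  rw [ProbabilityTheory.cond, integral_smul_measure, smul_eq_mul]
  by_cases h0 : μ s = 0
  · simp [Measure.restrict_eq_zero.2 h0]
  · refine le_mul_of_one_le_left hI ?_
    rw [ENNReal.toReal_inv]
    exact (one_le_inv₀ (ENNReal.toReal_pos h0 (measure_ne_top _ _))).2
      (ENNReal.toReal_le_of_le_ofReal zero_le_one (by simpa using prob_le_one))

/-- The penalizing constants of a procedure are bounded in terms of its error rate. -/
lemma mpBFDR_le_one_sub {β : ℕ → ℝ} (hβ : ∀ n, β n ∈ Set.Icc (0 : ℝ) 1)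
    {dhat : (n : ℕ) → (Fin n → Ξ) → Config m} (hdhat : H.IsNonMarginal M β dhat) (n : ℕ) :
    H.mpBFDR M dhat n ≤ 1 - β n := by
  have hβn := (hβ n).2
  calc H.mpBFDR M dhat n ≤ ∫ _, (1 - β n) ∂(M.law n)[|{x | dhat n x ≠ fun _ => false}] :=
        integral_mono_of_nonneg (Eventually.of_forall fun x => mFDR_nonneg)
          (integrable_const _)
          (Eventually.of_forall fun x => mFDR_le_one_sub hβn ((hdhat n).2 x _))
    _ ≤ 1 * (1 - β n) := by
        have := sub_nonneg.2 hβn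
        rw [integral_const, smul_eq_mul]
        gcongr
        exact measureReal_le_one
    _ = _ := one_mul _

/-- The probability of rejecting everything is controlled by `mpBFDR`. -/
lemma card_div_mul_le_mpBFDR (hreg : M.Regular h S a ς) (hm : 0 < m)
    {dhat : (n : ℕ) → (Fin n → Ξ) → Config m} (hmeas : ∀ n, Measurable (dhat n)) (n : ℕ) :
    ((Finset.univ.filter fun i => dt i = false).card : ℝ) / m *
        (M.law n).real {x | dhat n x = fun _ => true} ≤
      H.mpBFDR M dhat n + ∫ x, H.nullMass M dt n x ∂M.law n := by
  set κ := ((Finset.univ.filter fun i => dt i = false).card : ℝ) / m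
  have hmeas1 : MeasurableSet {x | dhat n x = fun _ => true} :=
    hmeas n (measurableSet_singleton _)
  have hsub : {x | dhat n x = fun _ => true} ⊆ {x | dhat n x ≠ fun _ => false} := by
    intro x hx h0
    rw [Set.mem_ofPred_eq] at hx
    rw [hx] at h0
    simpa using congrFun h0 ⟨0, hm⟩
  have hintM : Integrable (fun x => H.mFDR M n x (dhat n x)) (M.law n) :=
    .of_bound (aemeasurable_mFDR hreg (hmeas n)).aestronglyMeasurable 1
      (Eventually.of_forall fun x => by
        rw [Real.norm_of_nonneg mFDR_nonneg]; exact mFDR_le_one)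
  have hintV : Integrable (fun x => H.nullMass M dt n x) (M.law n) :=
    .of_bound (aemeasurable_nullMass hreg).aestronglyMeasurable m
      (Eventually.of_forall fun x => by
        rw [Real.norm_of_nonneg nullMass_nonneg]
        refine nullMass_le.trans (mul_le_of_le_one_right (Nat.cast_nonneg _) ?_)
        linarith [BayesModel.post_nonneg (M := M) n x (H.cell dt)])
  calc κ * (M.law n).real {x | dhat n x = fun _ => true}
      = ∫ x in {x | dhat n x = fun _ => true}, κ ∂M.law n := by simp [mul_comm]
    _ ≤ ∫ x in {x | dhat n x = fun _ => true},
          (H.mFDR M n x (dhat n x) + H.nullMass M dt n x) ∂M.law n := by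
        refine setIntegral_mono_on (integrable_const _) (hintM.add hintV).integrableOn hmeas1 ?_
        intro x hx
        rw [Set.mem_ofPred_eq] at hx
        rw [hx]
        linarith [le_mFDR_all (H := H) (M := M) (n := n) (x := x) (dt := dt) hm]
    _ = ∫ x in {x | dhat n x = fun _ => true}, H.mFDR M n x (dhat n x) ∂M.law n +
          ∫ x in {x | dhat n x = fun _ => true}, H.nullMass M dt n x ∂M.law n :=
        integral_add hintM.integrableOn hintV.integrableOn
    _ ≤ _ := by
        refine add_le_add ?_ (setIntegral_le_integral hintV
          (Eventually.of_forall fun x => nullMass_nonneg))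
        exact (setIntegral_mono_set hintM.integrableOn
          (Eventually.of_forall fun x => mFDR_nonneg) hsub.eventuallyLE).trans
          (setIntegral_le_integral_cond fun x => mFDR_nonneg)

lemma pBFNR_nonneg {dhat : (n : ℕ) → (Fin n → Ξ) → Config m} (n : ℕ) :
    0 ≤ H.pBFNR M dhat n := integral_nonneg fun _ => FNR_nonneg

lemma pBFNR_le (hreg : M.Regular h S a ς)
    {dhat : (n : ℕ) → (Fin n → Ξ) → Config m} (hmeas : ∀ n, Measurable (dhat n)) (n : ℕ) :
    H.pBFNR M dhat n ≤ (1 - (M.law n).real {x | dhat n x = fun _ => true})⁻¹ *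
      ∫ x, H.FNR M n x (dhat n x) ∂M.law n := by
  have hmeas1 : MeasurableSet {x | dhat n x = fun _ => true} :=
    hmeas n (measurableSet_singleton _)
  have hint : Integrable (fun x => H.FNR M n x (dhat n x)) (M.law n) :=
    .of_bound (aemeasurable_FNR hreg (hmeas n)).aestronglyMeasurable 1
      (Eventually.of_forall fun x => by
        rw [Real.norm_of_nonneg FNR_nonneg]; exact FNR_le_one)
  rw [pBFNR, ProbabilityTheory.cond, integral_smul_measure, smul_eq_mul, ENNReal.toReal_inv,
    ← probReal_compl_eq_one_sub hmeas1]
  exact mul_le_mul_of_nonneg_left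
    (setIntegral_le_integral hint (Eventually.of_forall fun x => FNR_nonneg))
    (inv_nonneg.2 measureReal_nonneg)

/-- The feasible range lies below the proportion of true nulls. -/
lemma IsolatedGroups.feasible_le (hB1 : H.IsolatedGroups dt) :
    ((m : ℝ) - (H.signalGroups dt).card) /
        (((Finset.univ.filter (fun i => dt i = true)).card : ℝ) +
          ((m : ℝ) - (H.signalGroups dt).card)) ≤
      ((Finset.univ.filter fun i => dt i = false).card : ℝ) / m := by
  have h1 : ((H.signalGroups dt).card : ℝ) < m := by exact_mod_cast hB1.1
  have h2 : ((Finset.univ.filter (fun i => dt i = true)).card : ℝ) ≤ (H.signalGroups dt).card := by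
    refine Nat.cast_le.2 (Finset.card_le_card fun i hi => ?_)
    simp only [signalGroups, Finset.mem_filter, Finset.mem_univ, true_and] at hi ⊢
    exact ⟨i, H.self_mem_group i, hi⟩
  have h3 : ((Finset.univ.filter (fun i => dt i = true)).card : ℝ) +
      (Finset.univ.filter (fun i => dt i = false)).card = m := by
    have := Finset.card_filter_add_card_filter_not (s := (Finset.univ : Finset (Fin m)))
      (fun i => dt i = true)
    simp only [Bool.not_eq_true, Finset.card_univ, Fintype.card_fin] at this
    exact_mod_cast this
  set s := ((Finset.univ.filter (fun i => dt i = true)).card : ℝ)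
  have hs : 0 ≤ s := Nat.cast_nonneg _
  rw [div_le_div_iff₀ (by linarith) (by linarith)]
  nlinarith

lemma IsTrueConfig.tendsto_pBFNR (hdt : H.IsTrueConfig M h dt) (hreg : M.Regular h S a ς)
    (hm : 0 < m) {dhat : (n : ℕ) → (Fin n → Ξ) → Config m} (hmeas : ∀ n, Measurable (dhat n))
    (hrej : ∀ᵐ ω ∂M.P, ∀ᶠ n in atTop, ∀ i, dt i = true → dhat n (M.data n ω) i = true)
    {α : ℝ} (hcontrol : Tendsto (H.mpBFDR M dhat) atTop (𝓝 α)) (hα : 0 < α)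
    (hακ : α < ((Finset.univ.filter fun i => dt i = false).card : ℝ) / m) :
    Tendsto (H.pBFNR M dhat) atTop (𝓝 0) := by
  have hV := hdt.tendsto_nullMass hreg
  have hEV : Tendsto (fun n => ∫ x, H.nullMass M dt n x ∂M.law n) atTop (𝓝 0) := by
    refine BayesModel.tendsto_integral_law_zero (C := m)
      (fun n => aemeasurable_nullMass hreg) (fun n x => ?_) hV
    rw [abs_of_nonneg nullMass_nonneg]
    refine nullMass_le.trans (mul_le_of_le_one_right (Nat.cast_nonneg _) ?_)
    linarith [BayesModel.post_nonneg (M := M) n x (H.cell dt)]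
  have hEF : Tendsto (fun n => ∫ x, H.FNR M n x (dhat n x) ∂M.law n) atTop (𝓝 0) := by
    refine BayesModel.tendsto_integral_law_zero (C := 1)
      (F := fun n x => H.FNR M n x (dhat n x))
      (fun n => aemeasurable_FNR hreg (hmeas n)) (fun n x => ?_) ?_
    · rw [abs_of_nonneg FNR_nonneg]
      exact FNR_le_one
    · filter_upwards [hV, hrej] with ω h1 h2
      exact tendsto_of_tendsto_of_tendsto_of_le_of_le' tendsto_const_nhds h1
        (Eventually.of_forall fun n => FNR_nonneg) (h2.mono fun n hn => FNR_le_nullMass hn)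
  set κ := ((Finset.univ.filter fun i => dt i = false).card : ℝ) / m
  have hκ : 0 < κ := hα.trans hακ
  -- the probability of not rejecting everything stays away from zero
  set q := (1 - α / κ) / 2 with hq
  have hq0 : 0 < q := by
    have : α / κ < 1 := (div_lt_one hκ).2 hακ
    linarith
  have h1 : ∀ᶠ n in atTop, q ≤ 1 - (M.law n).real {x | dhat n x = fun _ => true} := by
    have h2 := hcontrol.add hEV
    rw [add_zero] at h2
    have h3 : α < κ * (1 - q) := by
      have : κ * (1 - q) = (κ + α) / 2 := by rw [hq]; field_simp; ring
      linarith
    filter_upwards [h2.eventually_lt_const h3] with n hn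
    have h4 := card_div_mul_le_mpBFDR (H := H) (dt := dt) hreg hm hmeas n
    have h5 := lt_of_mul_lt_mul_left (h4.trans_lt hn) hκ.le
    linarith
  have h2 := hEF.const_mul q⁻¹
  rw [mul_zero] at h2
  refine tendsto_of_tendsto_of_tendsto_of_le_of_le' tendsto_const_nhds h2
    (Eventually.of_forall fun n => pBFNR_nonneg n) ?_
  filter_upwards [h1] with n hn
  refine (pBFNR_le hreg hmeas n).trans ?_
  gcongr
  exact integral_nonneg fun _ => FNR_nonneg

end TestingProblem

end NonMarginal

theorem mainTheorem10 {Ω Ξ ι : Type*} {T : ι → Type*} [MeasurableSpace Ω] [MeasurableSpace Ξ]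
    [∀ k, MeasurableSpace (T k)] {m : ℕ}
    (M : NonMarginal.BayesModel Ω Ξ ((k : ι) → T k))
    (H : NonMarginal.TestingProblem T m)
    (h : ((k : ι) → T k) → ℝ≥0∞) (S : ℕ → Set ((k : ι) → T k)) (a ς : ℝ)
    (hreg : M.Regular h S a ς)
    (dt : NonMarginal.Config m) (hdt : H.IsTrueConfig M h dt)
    (hς : ∀ i, dt i = false → M.prior (H.hyp i true) ≠ 0 →
      2 * M.hSet h (H.hyp i true) < ENNReal.ofReal ς)
    (hB1 : H.IsolatedGroups dt)
    (β : ℕ → ℝ) (hβ : ∀ n, β n ∈ Set.Icc (0 : ℝ) 1)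
    (dhat : (n : ℕ) → (Fin n → Ξ) → NonMarginal.Config m) (hdhat : H.IsNonMarginal M β dhat)
    (α : ℝ) (hα : 0 < α) (hcontrol : Tendsto (H.mpBFDR M dhat) atTop (𝓝 α)) :
    (∀ᵐ ω ∂M.P, limsup (fun n => H.logFNR M dhat n ω) atTop ≤ -H.HtildeMin M h dt) ∧
    (∀ (β' : ℕ → ℝ) (dhat' : (n : ℕ) → (Fin n → Ξ) → NonMarginal.Config m),
      (∀ n, β' n ∈ Set.Icc (0 : ℝ) 1) → 0 < liminf β' atTop → limsup β' atTop < 1 →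
      H.IsNonMarginal M β' dhat' →
      ∀ᵐ ω ∂M.P, limsup (fun n => H.logFNR M dhat n ω) atTop ≤
        liminf (fun n => H.logFNR M dhat' n ω) atTop) ∧
    (α < ((m : ℝ) - (H.signalGroups dt).card) /
        (((Finset.univ.filter (fun i => dt i = true)).card : ℝ) +
          ((m : ℝ) - (H.signalGroups dt).card)) →
      Tendsto (H.pBFNR M dhat) atTop (𝓝 0)) := by
  -- a positive limit of `mpBFDR` keeps the penalizing constants away from `1`
  have hβb : ∀ᶠ n in atTop, β n ≤ 1 - α / 2 := by
    filter_upwards [hcontrol.eventually_const_lt (half_lt_self hα)] with n hn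
    linarith [NonMarginal.TestingProblem.mpBFDR_le_one_sub hβ hdhat n]
  have hrej := hdt.eventually_reject hreg hβ (show 1 - α / 2 < 1 by linarith) hβb hdhat
  have hup := NonMarginal.TestingProblem.ae_limsup_logFNR_le hreg hς hrej
  refine ⟨hup, ?_, fun hαlt => ?_⟩
  · intro β' dhat' hβ' hlim _ hdhat'
    have hbdd : IsBoundedUnder (· ≥ ·) atTop β' := isBoundedUnder_of ⟨0, fun n => (hβ' n).1⟩
    have hacc := hdt.eventually_accept hreg hβ' (half_pos hlim)
      (eventually_lt_of_lt_liminf (half_lt_self hlim) hbdd) hdhat'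
    filter_upwards [hup, NonMarginal.TestingProblem.ae_le_liminf_logFNR hreg hacc]
      with ω h1 h2 using h1.trans h2
  · exact hdt.tendsto_pBFNR hreg ((Nat.zero_le _).trans_lt hB1.1) (fun n => (hdhat n).1) hrej
      hcontrol hα (hαlt.trans_le hB1.feasible_le)
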